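/- All spaces are pointed and have the (pointed) homotopy type of a connected CW-complex; maps and homotopies preserve base points, and $\simeq$ denotes pointed homotopy equivalence. For an H-space $X$ let $\mathrm{End}(X)=([X,X],+,\cdot)$ be the loop near-ring of homotopy classes of self-maps of $X$, where $\cdot$ is composition, $+$ is induced by the H-structure, $\mathbf 0_X$ is the class of the constant map and $\mathbf 1_X$ that of the identity. The space $X$ is \emph{indecomposable} if $\mathbf 0_X\neq\mathbf 1_X$ (i.e. $X$ is not contractible) and $\mathbf 0_X,\mathbf 1_X$ are the only idempotents of $\mathrm{End}(X)$. An \emph{$N$-subloop} of a loop near-ring $N$ is a subloop $I$ of $(N,+)$ (a subset containing $0$ and closed under addition and under solving $a+x=b$ and $y+a=b$ with $a,b\in I$) such that $NI\subseteq I$; $N$ is \emph{local} if it has a unique maximal proper $N$-subloop. An H-space $X$ is \emph{strongly indecomposable} if $\mathrm{End}(X)$ is local. A space $Z$ is a \emph{retract} of $X$ if there are maps $j\colon Z\to X$ and $p\colon X\to Z$ with $pj\simeq \mathbf 1_Z$. \textbf{Theorem.} Assume that an H-space $X$ admits a finite product decomposition $X\simeq X_1\times\cdots\times X_n$ into strongly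 indecomposable H-spaces $X_i$. Then: (i) Any indecomposable retract $Z$ of $X$ is strongly indecomposable (that is, $Z$ admits an H-structure, and $\mathrm{End}(Z)$ is local for every H-structure on $Z$). Moreover, there is an index $i$ such that $Z\simeq X_i$. (ii) If $X\simeq X'_1\times\cdots\times X'_m$ is any other decomposition of $X$ into indecomposable factors $X'_k$, then $m=n$, and there is a permutation $\varphi$ such that $X_i\simeq X'_{\varphi(i)}$ for all $i$. -/

import Mathlib

universe u v w t

/-- A pointed topological space. -/
structure PtdSpace : Type (u + 1) where
  carrier : Type u
  [top : TopologicalSpace carrier]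
  pt : carrier

namespace PtdSpace

instance : CoeSort PtdSpace.{u} (Type u) := ⟨PtdSpace.carrier⟩

instance (X : PtdSpace.{u}) : TopologicalSpace X := X.top

/-- The product of a family of pointed spaces, with the product topology. -/
def pi {ι : Type w} (F : ι → PtdSpace.{v}) : PtdSpace.{max w v} where
  carrier := ∀ i, F i
  pt := fun i => (F i).pt

/-- Base-point preserving continuous maps. -/
def Map (X : PtdSpace.{u}) (Y : PtdSpace.{v}) : Type (max u v) :=
  {f : C(X, Y) // f X.pt = Y.pt}

namespace Map

variable {X : PtdSpace.{u}} {Y : PtdSpace.{v}} {Z : PtdSpace.{w}}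

/-- The identity map. -/
def id (X : PtdSpace.{u}) : Map X X := ⟨ContinuousMap.id X, rfl⟩

/-- The constant map at the base point. -/
def zero (X : PtdSpace.{u}) (Y : PtdSpace.{v}) : Map X Y :=
  ⟨ContinuousMap.const X Y.pt, rfl⟩

/-- Composition `g ∘ f`. -/
def comp (g : Map Y Z) (f : Map X Y) : Map X Z :=
  ⟨g.1.comp f.1, (congrArg g.1 f.2).trans g.2⟩

/-- Base-point preserving homotopy of pointed maps. -/
def Homotopic (f g : Map X Y) : Prop := f.1.HomotopicRel g.1 {X.pt}

theorem Homotopic.comp {f f' : Map X Y} {g g' : Map Y Z}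
    (hg : Homotopic g g') (hf : Homotopic f f') : Homotopic (g.comp f) (g'.comp f') := by
  obtain ⟨G⟩ := hg
  refine ContinuousMap.HomotopicRel.trans (hf.comp_continuousMap g.1)
    ⟨⟨G.toHomotopy.compContinuousMap f'.1, ?_⟩⟩
  rintro s x rfl
  refine G.eq_fst s ?_
  exact f'.2

/-- The setoid of pointed homotopy. -/
instance setoid (X : PtdSpace.{u}) (Y : PtdSpace.{v}) : Setoid (Map X Y) where
  r := Homotopic
  iseqv := ⟨fun _ => ContinuousMap.HomotopicRel.refl _,
    fun h => ContinuousMap.HomotopicRel.symm h,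
    fun h k => ContinuousMap.HomotopicRel.trans h k⟩

end Map

/-- `X` and `Y` are pointed homotopy equivalent. -/
def HEquiv (X : PtdSpace.{u}) (Y : PtdSpace.{v}) : Prop :=
  ∃ (f : Map X Y) (g : Map Y X),
    (g.comp f).Homotopic (Map.id X) ∧ (f.comp g).Homotopic (Map.id Y)

/-- `Z` is a retract of `X`, in the pointed homotopy category. -/
def IsRetract (Z : PtdSpace.{v}) (X : PtdSpace.{u}) : Prop :=
  ∃ (j : Map Z X) (p : Map X Z), (p.comp j).Homotopic (Map.id Z)

/-- `X` has the (pointed) homotopy type of a connected CW-complex; as usual, the base point of a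
pointed CW-complex is a vertex. -/
def HasConnectedCWType (X : PtdSpace.{u}) : Prop :=
  ∃ (K : PtdSpace.{u}) (_ : T2Space K) (_ : ConnectedSpace K)
    (_ : Topology.CWComplex (Set.univ : Set K)),
    (∃ i : Topology.RelCWComplex.cell (Set.univ : Set K) 0,
      K.pt ∈ Topology.RelCWComplex.openCell 0 i) ∧ HEquiv X K

/-- An H-space structure on the pointed space `X`, with the base point as the homotopy unit. -/
structure HStructure (X : PtdSpace.{u}) where
  toHSpace : HSpace X
  e_eq : toHSpace.e = X.pt

/-- The sum `f + g = μ ∘ (f, g)` of two maps into an H-space. -/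
def Map.add {X : PtdSpace.{u}} {Y : PtdSpace.{v}} (H : HStructure Y) (f g : Map X Y) : Map X Y :=
  ⟨H.toHSpace.hmul.comp (f.1.prodMk g.1), by
    have h := H.toHSpace.hmul_e_e
    rw [H.e_eq] at h
    simpa [f.2, g.2] using h⟩

theorem Map.Homotopic.add {X : PtdSpace.{u}} {Y : PtdSpace.{v}} (H : HStructure Y)
    {f f' g g' : Map X Y} (hf : f.Homotopic f') (hg : g.Homotopic g') :
    (Map.add H f g).Homotopic (Map.add H f' g') := by
  obtain ⟨F⟩ := hf
  obtain ⟨G⟩ := hg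
  exact ⟨(ContinuousMap.HomotopyRel.prod F G).compContinuousMap H.toHSpace.hmul⟩

/-- The set `[X, X]` of pointed homotopy classes of pointed self-maps. -/
def SelfMaps (X : PtdSpace.{u}) : Type u := Quotient (Map.setoid X X)

instance (X : PtdSpace.{u}) : Zero (SelfMaps X) := ⟨Quotient.mk _ (Map.zero X X)⟩

instance (X : PtdSpace.{u}) : One (SelfMaps X) := ⟨Quotient.mk _ (Map.id X)⟩

/-- Multiplication in `[X, X]` is composition. -/
instance (X : PtdSpace.{u}) : Mul (SelfMaps X) :=
  ⟨Quotient.map₂ Map.comp fun _ _ hg _ _ hf => Map.Homotopic.comp hg hf⟩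

/-- The set `[X, X]`, for `X` with a chosen H-structure, carrying the operations of the
loop near-ring `End(X)`. -/
def End (X : PtdSpace.{u}) (_H : HStructure X) : Type u := SelfMaps X

instance (X : PtdSpace.{u}) (H : HStructure X) : Zero (End X H) :=
  inferInstanceAs (Zero (SelfMaps X))

instance (X : PtdSpace.{u}) (H : HStructure X) : One (End X H) :=
  inferInstanceAs (One (SelfMaps X))

instance (X : PtdSpace.{u}) (H : HStructure X) : Mul (End X H) :=
  inferInstanceAs (Mul (SelfMaps X))

/-- Addition in `End(X)` is induced by the H-structure. -/
instance (X : PtdSpace.{u}) (H : HStructure X) : Add (End X H) :=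
  ⟨Quotient.map₂ (Map.add H) fun _ _ hf _ _ hg => Map.Homotopic.add H hf hg⟩

end PtdSpace

/-- `N`-subloops of a loop near-ring `N`: subsets which contain zero, are closed under addition
and under both difference operations (the difference of `a` and `b` being the solution `x` of
`a + x = b`, respectively `x + a = b`), and are stable under left multiplication by `N`. -/
structure IsNSubloop {N : Type u} [Zero N] [Add N] [Mul N] (I : Set N) : Prop where
  zero_mem : 0 ∈ I
  add_mem : ∀ a ∈ I, ∀ b ∈ I, a + b ∈ I
  left_diff_mem : ∀ a ∈ I, ∀ b ∈ I, ∀ x, a + x = b → x ∈ I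
  right_diff_mem : ∀ a ∈ I, ∀ b ∈ I, ∀ x, x + a = b → x ∈ I
  mul_mem : ∀ n : N, ∀ a ∈ I, n * a ∈ I

/-- A maximal `N`-subloop: a proper `N`-subloop contained in no other proper `N`-subloop. -/
def IsMaximalNSubloop {N : Type u} [Zero N] [Add N] [Mul N] (J : Set N) : Prop :=
  IsNSubloop J ∧ J ≠ Set.univ ∧
    ∀ K : Set N, IsNSubloop K → K ≠ Set.univ → J ⊆ K → K = J

/-- A loop near-ring is local if it has a unique maximal `N`-subloop. -/
def IsLocalLoopNearRing (N : Type u) [Zero N] [Add N] [Mul N] : Prop :=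
  ∃! J : Set N, IsMaximalNSubloop J

namespace PtdSpace

/-- `X` is indecomposable: it is not contractible, and `0` and `1` are the only idempotents of
`[X, X]`. The H-structure does not enter. -/
def Indecomposable (X : PtdSpace.{u}) : Prop :=
  (0 : SelfMaps X) ≠ 1 ∧ ∀ e : SelfMaps X, e * e = e → e = 0 ∨ e = 1

/-- The H-space `X` is strongly indecomposable: `End(X)` is a local loop near-ring. -/
def StronglyIndecomposable (X : PtdSpace.{u}) (H : HStructure X) : Prop :=
  IsLocalLoopNearRing (End X H)

end PtdSpace

/-!
Let `π X` be the product of all homotopy groups of `X`. For an H-space it is an abelian group, and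
the endomorphisms of `π X` induced by self-maps form a ring `piRing X`, negatives being obtained by
inverting the shear map `(a, b) ↦ (a, a + b)` of `X × X`. By Whitehead's theorem a self-map is a
homotopy equivalence if and only if it becomes a unit in this ring, hence maximal `N`-subloops of
`End X` correspond to maximal left ideals of `piRing X`, and `X` is strongly indecomposable if and
only if `piRing X` is local.

A retract `j : Z → X`, `p : X → Z` yields the idempotent `j p` of `piRing X`, whose corner ring is
`piRing Z`, so a product decomposition of `X` into strongly indecomposable factors is a complete
family of orthogonal local idempotents. The theorem then follows from the exchange property and the
Krull–Schmidt–Azumaya theorem. The one point where the ring does not suffice is an indecomposable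
retract `Z`, since idempotents of `piRing Z` need not lift to idempotent homotopy classes: the
exchange property makes some `X_i` a retract of `Z`, and the projection onto it is a genuine
idempotent of `[Z, Z]`.
-/

section Idempotents

variable {R : Type*} [Ring R]

/-- Murray–von Neumann equivalence of idempotents, witnessed by two mutually quasi-inverse
elements; for endomorphisms it says that `e` and `f` have isomorphic images. -/
def IdempotentEquiv (e f : R) : Prop :=
  ∃ a b, a * b * a = a ∧ b * a * b = b ∧ a * b = e ∧ b * a = f

/-- A local idempotent is an idempotent `e` whose corner ring `e R e` is local. -/
def IsLocalIdempotent (e : R) : Prop :=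
  ∃ he : IsIdempotentElem e, IsLocalRing he.Corner

namespace IdempotentEquiv

variable {e f g : R}

theorem symm : IdempotentEquiv e f → IdempotentEquiv f e := fun ⟨a, b, ha, hb, hab, hba⟩ =>
  ⟨b, a, hb, ha, hba, hab⟩

theorem trans : IdempotentEquiv e f → IdempotentEquiv f g → IdempotentEquiv e g := by
  rintro ⟨a, b, ha, -, rfl, rfl⟩ ⟨c, d, -, hd, hcd, rfl⟩
  have hac : a * c * (d * b) = a * b := by
    rw [← mul_assoc, mul_assoc a c d, hcd, ← mul_assoc, ha]
  have hdb : d * b * (a * c) = d * c := by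
    rw [← mul_assoc, mul_assoc d b a, ← hcd, ← mul_assoc, hd]
  exact ⟨a * c, d * b, by rw [hac, ← mul_assoc, ha], by rw [hdb, ← mul_assoc, hd], hac, hdb⟩

theorem of_mul_eq_left (hef : e * f = e) (hfe : f * e = f) : IdempotentEquiv e f :=
  ⟨e, f, by rw [mul_assoc, hfe, hef], by rw [mul_assoc, hef, hfe], hef, hfe⟩

theorem of_mul_eq_right (hef : e * f = f) (hfe : f * e = e) : IdempotentEquiv e f :=
  ⟨f, e, by rw [hfe, hef], by rw [hef, hfe], hfe, hef⟩

theorem conj {a b : R} (he : IsIdempotentElem e) (habe : a * b * e = e) :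
    IdempotentEquiv e (b * e * a) := by
  have h : e * a * (b * e) = e := by rw [mul_assoc, ← mul_assoc a, habe, he.eq]
  have h' : b * e * (e * a) = b * e * a := by rw [mul_assoc, ← mul_assoc e, he.eq, ← mul_assoc]
  refine ⟨e * a, b * e, ?_, ?_, h, h'⟩
  · rw [h, ← mul_assoc, he.eq]
  · rw [mul_assoc, h, mul_assoc, he.eq]

/-- The ring isomorphism `x ↦ b x a` of corner rings. -/
def cornerEquiv {a b : R} (ha : a * b * a = a) (hb : b * a * b = b)
    (he : IsIdempotentElem (a * b)) (hf : IsIdempotentElem (b * a)) : he.Corner ≃+* hf.Corner where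
  toFun x := ⟨b * x.1 * a, by
    rw [Subsemigroup.mem_corner_iff hf]
    constructor
    · rw [← mul_assoc, ← mul_assoc, hb]
    · rw [mul_assoc, ← mul_assoc a, ha]⟩
  invFun x := ⟨a * x.1 * b, by
    rw [Subsemigroup.mem_corner_iff he]
    constructor
    · rw [← mul_assoc, ← mul_assoc, ha]
    · rw [mul_assoc, ← mul_assoc b, hb]⟩
  left_inv x := by
    obtain ⟨hl, hr⟩ := (Subsemigroup.mem_corner_iff he).mp x.2
    refine Subtype.ext ?_
    change a * (b * x.1 * a) * b = x.1
    rw [mul_assoc, mul_assoc _ a b, mul_assoc b, hr, ← mul_assoc, hl]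
  right_inv x := by
    obtain ⟨hl, hr⟩ := (Subsemigroup.mem_corner_iff hf).mp x.2
    refine Subtype.ext ?_
    change b * (a * x.1 * b) * a = x.1
    rw [mul_assoc, mul_assoc _ b a, mul_assoc a, hr, ← mul_assoc, hl]
  map_mul' x y := by
    obtain ⟨-, hr⟩ := (Subsemigroup.mem_corner_iff he).mp x.2
    refine Subtype.ext ?_
    change b * (x.1 * y.1) * a = b * x.1 * a * (b * y.1 * a)
    rw [← mul_assoc, ← mul_assoc, ← mul_assoc, mul_assoc _ a b, mul_assoc b _ (a * b), hr,
      mul_assoc b]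
  map_add' x y := Subtype.ext <| by
    change b * (x.1 + y.1) * a = b * x.1 * a + b * y.1 * a
    rw [mul_add, add_mul]

end IdempotentEquiv

theorem isLocalRing_of_ringEquiv {S : Type*} [Ring S] [IsLocalRing R] (φ : R ≃+* S) :
    IsLocalRing S := by
  have := φ.symm.toEquiv.nontrivial
  refine .of_isUnit_or_isUnit_one_sub_self fun s => ?_
  have h : φ.symm s + φ.symm (1 - s) = 1 := by rw [← map_add, add_sub_cancel, map_one]
  simpa only [MulEquiv.isUnit_map] using IsLocalRing.isUnit_or_isUnit_of_add_one h

theorem eq_zero_or_eq_one_of_isIdempotentElem [IsLocalRing R] {e : R} (he : IsIdempotentElem e) :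
    e = 0 ∨ e = 1 := by
  rcases IsLocalRing.isUnit_or_isUnit_of_add_one (add_sub_cancel e 1) with h | h
  · exact .inr (h.mul_left_cancel (he.eq.trans (mul_one e).symm))
  · refine .inl (h.mul_left_cancel ?_)
    rw [sub_mul, one_mul, he.eq, sub_self, mul_zero]

/-- The compression `x ↦ f x f` onto the corner ring of `f`. -/
def compress {f : R} (hf : IsIdempotentElem f) : R →+ hf.Corner where
  toFun x := ⟨f * x * f, x, rfl⟩
  map_zero' := Subtype.ext <| by
    change f * 0 * f = 0
    rw [mul_zero, zero_mul]
  map_add' x y := Subtype.ext <| by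
    change f * (x + y) * f = f * x * f + f * y * f
    rw [mul_add, add_mul]

namespace IsLocalIdempotent

variable {e f : R}

theorem isIdempotentElem (he : IsLocalIdempotent e) : IsIdempotentElem e := he.1

theorem ne_zero (he : IsLocalIdempotent e) : e ≠ 0 := by
  obtain ⟨he, hloc⟩ := he
  exact fun h => one_ne_zero (α := he.Corner) (Subtype.ext h)

theorem of_idempotentEquiv (he : IsLocalIdempotent e) (hef : IdempotentEquiv e f) :
    IsLocalIdempotent f := by
  obtain ⟨a, b, ha, hb, rfl, rfl⟩ := hef
  obtain ⟨he, hloc⟩ := he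
  have hf : IsIdempotentElem (b * a) := by rw [IsIdempotentElem, ← mul_assoc, hb]
  exact ⟨hf, isLocalRing_of_ringEquiv (IdempotentEquiv.cornerEquiv ha hb he hf)⟩

theorem eq_of_mul_eq (he : IsLocalIdempotent e) (hf : IsIdempotentElem f) (hne : f ≠ 0)
    (hef : e * f = f) (hfe : f * e = f) : f = e := by
  obtain ⟨he, hloc⟩ := he
  let f' : he.Corner := ⟨f, (Subsemigroup.mem_corner_iff he).mpr ⟨hef, hfe⟩⟩
  rcases eq_zero_or_eq_one_of_isIdempotentElem (e := f') (Subtype.ext hf) with h | h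
  · exact absurd (congrArg Subtype.val h) hne
  · exact congrArg Subtype.val h

/-- Here `e y e` is not invertible in the local ring `e R e`, so `e + e y e` has an inverse `c`
there, and `f - y c f` is a left inverse of `f + y (f e f)`. -/
theorem compress_mem_jacobson (he : IsLocalIdempotent e) (hf : IsIdempotentElem f)
    (h : ∀ u, f * u = u → u * e = u → e * u ≠ e) :
    compress hf e ∈ Ideal.jacobson (⊥ : Ideal hf.Corner) := by
  obtain ⟨he, hloc⟩ := he
  rw [Ideal.mem_jacobson_iff]
  rintro ⟨y, hy⟩
  obtain ⟨hfy, hyf⟩ := (Subsemigroup.mem_corner_iff hf).mp hy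
  have ht : ¬ IsUnit (-compress he y) := by
    intro ht
    obtain ⟨⟨d, hd⟩, htd⟩ := ht.exists_right_inv
    obtain ⟨hed, hde⟩ := (Subsemigroup.mem_corner_iff he).mp hd
    refine h (-(y * d)) (by rw [mul_neg, ← mul_assoc, hfy]) (by rw [neg_mul, mul_assoc, hde]) ?_
    have hyd : -(e * y * e) * d = e := congrArg Subtype.val htd
    rwa [neg_mul, mul_assoc, hed, mul_assoc, ← mul_neg] at hyd
  obtain ⟨⟨c, hc⟩, htc⟩ := ((IsLocalRing.isUnit_or_isUnit_of_add_one
    (neg_add_cancel_left (compress he y) 1)).resolve_left ht).exists_left_inv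
  have hce := ((Subsemigroup.mem_corner_iff he).mp hc).2
  have hc' : c + c * y * e = e := by
    have : c * (e * y * e + e) = e := congrArg Subtype.val htc
    rwa [mul_add, hce, ← mul_assoc, ← mul_assoc, hce, add_comm] at this
  refine ⟨⟨f - y * c * f, (Subsemigroup.mem_corner_iff hf).mpr ⟨?_, ?_⟩⟩, ?_⟩
  · rw [mul_sub, hf.eq, ← mul_assoc, ← mul_assoc, hfy]
  · rw [sub_mul, hf.eq, mul_assoc _ f f, hf.eq]
  rw [Ideal.mem_bot]
  refine Subtype.ext ?_
  change (f - y * c * f) * y * (f * e * f) + (f - y * c * f) - f = 0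
  calc (f - y * c * f) * y * (f * e * f) + (f - y * c * f) - f
      = (f * y * f) * e * f - y * c * (f * y * f) * e * f - y * c * f := by noncomm_ring
    _ = y * (e - (c + c * y * e)) * f := by rw [hfy, hyf]; noncomm_ring
    _ = 0 := by rw [hc', sub_self, mul_zero, zero_mul]

/-- Otherwise all the summands of the unit of `f R f` lie in its Jacobson radical. -/
theorem exists_exchange {ι : Type*} {s : Finset ι} {e : ι → R}
    (he : ∀ i, IsLocalIdempotent (e i)) (hf : IsIdempotentElem f) (hne : f ≠ 0)
    (hsum : f * (∑ i ∈ s, e i) * f = f) :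
    ∃ i ∈ s, ∃ u, f * u = u ∧ u * e i = u ∧ e i * u = e i := by
  by_contra! h
  have hone : (1 : hf.Corner) ∈ Ideal.jacobson (⊥ : Ideal hf.Corner) := by
    have hcompress : compress hf (∑ i ∈ s, e i) = 1 := Subtype.ext hsum
    rw [← hcompress, map_sum]
    exact sum_mem fun i hi => (he i).compress_mem_jacobson hf (h i hi)
  rw [← Ideal.eq_top_iff_one, Ideal.jacobson_eq_top_iff, Ideal.eq_top_iff_one,
    Ideal.mem_bot] at hone
  exact hne (congrArg Subtype.val hone)

end IsLocalIdempotent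

namespace IdempotentEquiv

/-- The idempotent `u` has the image of `e` and the kernel of `f`. -/
theorem sub {E e f u : R} (hE : IsIdempotentElem E) (hEe : E * e = e) (heE : e * E = e)
    (hEf : E * f = f) (hfE : f * E = f) (heu : e * u = u) (hue : u * e = e) (huf : u * f = u)
    (hfu : f * u = f) : IdempotentEquiv (E - e) (E - f) := by
  have hEu : E * u = u := by rw [← heu, ← mul_assoc, hEe]
  have huE : u * E = u := by rw [← huf, mul_assoc, hfE]
  have heu' : IdempotentEquiv (E - e) (E - u) := of_mul_eq_left
    (by simp only [sub_mul, mul_sub, hE.eq, hEu, heE, heu, sub_self, sub_zero])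
    (by simp only [sub_mul, mul_sub, hE.eq, hEe, huE, hue, sub_self, sub_zero])
  have huf' : IdempotentEquiv (E - u) (E - f) := of_mul_eq_right
    (by simp only [sub_mul, mul_sub, hE.eq, hEf, huE, huf, sub_sub_sub_cancel_right])
    (by simp only [sub_mul, mul_sub, hE.eq, hEu, hfE, hfu, sub_sub_sub_cancel_right])
  exact heu'.trans huf'

end IdempotentEquiv

theorem sum_subtype_ne {κ : Type*} [Fintype κ] [DecidableEq κ] (f : κ → R) (k : κ) :
    ∑ l : {l // l ≠ k}, f l = ∑ l, f l - f k :=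
  eq_sub_of_add_eq' (Fintype.sum_eq_add_sum_subtype_ne f k).symm

theorem sum_mul_of_mem {κ : Type*} [Fintype κ] {f : κ → R} (hf : OrthogonalIdempotents f) (k : κ) :
    (∑ l, f l) * f k = f k := by
  classical
  simp only [Finset.sum_mul, hf.mul_eq, Finset.sum_ite_eq', Finset.mem_univ, if_true]

theorem orthogonalIdempotents_conj {κ : Type*} {f : κ → R} (hf : OrthogonalIdempotents f) {a b : R}
    (h : ∀ k, b * a * f k = f k) : OrthogonalIdempotents fun k => a * f k * b := by
  have hmul (k l) : a * f k * b * (a * f l * b) = a * (f k * f l) * b := by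
    nth_rw 2 [← h l]
    noncomm_ring
  exact ⟨fun k => by rw [IsIdempotentElem, hmul, (hf.idem k).eq],
    fun k l hkl => by simp only [hmul, hf.ortho hkl, mul_zero, zero_mul]⟩

theorem IsLocalIdempotent.exists_idempotentEquiv_sub {κ : Type*} [Fintype κ] {e : R} {f : κ → R}
    (he : IsLocalIdempotent e) (hf : OrthogonalIdempotents f) (hfl : ∀ k, IsLocalIdempotent (f k))
    (hEe : (∑ k, f k) * e = e) (heE : e * (∑ k, f k) = e) :
    ∃ k, IdempotentEquiv e (f k) ∧ IdempotentEquiv (∑ k, f k - e) (∑ k, f k - f k) := by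
  obtain ⟨k, -, u, heu, huf, hfu⟩ :=
    exists_exchange hfl he.isIdempotentElem he.ne_zero (by rw [heE, he.isIdempotentElem.eq])
  have huu : u * u = u := by nth_rw 1 [← huf, mul_assoc, hfu, huf]
  have hue : u * e = e := by
    refine he.eq_of_mul_eq ?_ ?_ (by rw [← mul_assoc, heu])
      (by rw [mul_assoc, he.isIdempotentElem.eq])
    · rw [IsIdempotentElem, mul_assoc, ← mul_assoc e, heu, ← mul_assoc, huu]
    · refine fun h => (hfl k).ne_zero ?_
      calc f k = f k * (u * (e * u)) := by rw [heu, huu, hfu]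
        _ = 0 := by rw [← mul_assoc u, h, zero_mul, mul_zero]
  have hfE : f k * (∑ k, f k) = f k := hf.mul_sum_of_mem (Finset.mem_univ k)
  refine ⟨k, (IdempotentEquiv.of_mul_eq_right heu hue).trans
    (IdempotentEquiv.of_mul_eq_left huf hfu), ?_⟩
  exact .sub hf.isIdempotentElem_sum hEe heE (sum_mul_of_mem hf k) hfE heu hue huf hfu

/-- The Krull–Schmidt–Azumaya theorem for orthogonal families of local idempotents. -/
theorem exists_equiv_idempotentEquiv {ι κ : Type*} [Fintype ι] [Fintype κ] {e : ι → R} {f : κ → R}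
    (he : OrthogonalIdempotents e) (hf : OrthogonalIdempotents f) (hsum : ∑ i, e i = ∑ k, f k)
    (hel : ∀ i, IsLocalIdempotent (e i)) (hfl : ∀ k, IsLocalIdempotent (f k)) :
    ∃ σ : ι ≃ κ, ∀ i, IdempotentEquiv (e i) (f (σ i)) := by
  classical
  induction hn : Fintype.card ι generalizing ι κ with
  | zero =>
    have := Fintype.card_eq_zero_iff.mp hn
    have : IsEmpty κ := by
      refine ⟨fun k => (hfl k).ne_zero ?_⟩
      rw [← hf.mul_sum_of_mem (Finset.mem_univ k), ← hsum, Finset.univ_eq_empty, Finset.sum_empty,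
        mul_zero]
    exact ⟨Equiv.equivOfIsEmpty ι κ, isEmptyElim⟩
  | succ n ih =>
    obtain ⟨i⟩ : Nonempty ι := Fintype.card_pos_iff.mp (by omega)
    obtain ⟨k, hik, a, b, ha, -, hab, hba⟩ := (hel i).exists_idempotentEquiv_sub hf hfl
      (by rw [← hsum, sum_mul_of_mem he]) (by rw [← hsum, he.mul_sum_of_mem (Finset.mem_univ i)])
    have hfix (l : {l // l ≠ k}) : b * a * f l = f l := by
      rw [hba, sub_mul, sum_mul_of_mem hf, hf.ortho l.2.symm, sub_zero]
    have hsum' : ∑ j : {j // j ≠ i}, e j = ∑ l : {l // l ≠ k}, a * f l * b := by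
      rw [← Finset.sum_mul, ← Finset.mul_sum, sum_subtype_ne f, ← hba, ← mul_assoc, ha, hab, ← hsum,
        sum_subtype_ne e]
    have hconj (l : {l // l ≠ k}) : IdempotentEquiv (f l) (a * f l * b) :=
      .conj (hf.idem l) (hfix l)
    obtain ⟨σ, hσ⟩ := ih (he.embedding (.subtype _))
      (orthogonalIdempotents_conj (hf.embedding (.subtype _)) hfix) hsum' (fun j => hel j)
      (fun l => (hfl l).of_idempotentEquiv (hconj l))
      ((Set.card_ne_eq i).trans (by rw [hn, Nat.add_sub_cancel]))
    refine ⟨((Equiv.optionSubtypeNe i).symm.trans σ.optionCongr).trans (Equiv.optionSubtypeNe k),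
      fun j => ?_⟩
    by_cases hj : j = i
    · subst hj
      simpa using hik
    · simpa [Equiv.optionSubtypeNe_symm_of_ne hj] using (hσ ⟨j, hj⟩).trans (hconj _).symm

end Idempotents

section LocalRing

variable {R : Type*} [Ring R]

theorem isUnit_of_mul_eq_one_of_isLocalRing [IsLocalRing R] {x y : R} (h : y * x = 1) :
    IsUnit x := by
  have hxy : IsIdempotentElem (x * y) := by
    rw [IsIdempotentElem, mul_assoc, ← mul_assoc y, h, one_mul]
  rcases eq_zero_or_eq_one_of_isIdempotentElem hxy with h0 | h1
  · refine absurd ?_ (one_ne_zero (α := R))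
    calc (1 : R) = y * (x * y) * x := by rw [← mul_assoc, h, one_mul, h]
      _ = 0 := by rw [h0, mul_zero, zero_mul]
  · exact isUnit_iff_exists.mpr ⟨y, h1, h⟩

theorem exists_mul_eq_one_of_notMem {M : Ideal R} (hM : ∀ I : Ideal R, I.IsMaximal → I = M) {x : R}
    (hx : x ∉ M) : ∃ y, y * x = 1 := by
  by_contra! h
  obtain ⟨I, hI, hxI⟩ := Ideal.exists_le_maximal (Ideal.span {x}) fun htop => by
    obtain ⟨y, hy⟩ := Ideal.mem_span_singleton'.mp ((Ideal.eq_top_iff_one _).mp htop)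
    exact h y hy
  exact hx (hM I hI ▸ hxI (Ideal.mem_span_singleton_self x))

theorem isUnit_of_notMem {M : Ideal R} (hM : M.IsMaximal)
    (huniq : ∀ I : Ideal R, I.IsMaximal → I = M) {x : R} (hx : x ∉ M) : IsUnit x := by
  obtain ⟨y, hyx⟩ := exists_mul_eq_one_of_notMem huniq hx
  have hy : y ∉ M := by
    intro hy
    have hxy : 1 - x * y ∉ M := fun h =>
      hM.ne_top ((Ideal.eq_top_iff_one M).mpr (by simpa using M.add_mem h (M.mul_mem_left x hy)))
    obtain ⟨z, hz⟩ := exists_mul_eq_one_of_notMem huniq hxy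
    have hzero : x = 0 := by
      calc x = z * (1 - x * y) * x := by rw [hz, one_mul]
        _ = z * (x - x * (y * x)) := by noncomm_ring
        _ = 0 := by rw [hyx, mul_one, sub_self, mul_zero]
    exact hx (hzero ▸ M.zero_mem)
  obtain ⟨z, hzy⟩ := exists_mul_eq_one_of_notMem huniq hy
  exact isUnit_iff_exists.mpr ⟨y, left_inv_eq_right_inv hzy hyx ▸ hzy, hyx⟩

theorem existsUnique_isMaximal_of_isLocalRing [IsLocalRing R] : ∃! M : Ideal R, M.IsMaximal := by
  let M : Ideal R :=
    { carrier := nonunits R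
      zero_mem' := not_isUnit_zero
      add_mem' := IsLocalRing.nonunits_add
      smul_mem' := fun r x hx hrx => hx <| by
        obtain ⟨y, hy⟩ := hrx.exists_left_inv
        exact isUnit_of_mul_eq_one_of_isLocalRing (by rw [mul_assoc]; exact hy) }
  have hM : ∀ I : Ideal R, I ≠ ⊤ → I ≤ M := fun I hI x hx hu => hI (I.eq_top_of_isUnit_mem hx hu)
  have hMtop : M ≠ ⊤ := fun h => (Ideal.eq_top_iff_one M).mp h isUnit_one
  refine ⟨M, Ideal.isMaximal_def.mpr ⟨hMtop, fun I hI => ?_⟩, fun I hI => ?_⟩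
  · exact by_contra fun hI' => hI.not_ge (hM I hI')
  · exact hI.eq_of_le hMtop (hM I hI.ne_top)

theorem isLocalRing_iff_existsUnique_isMaximal :
    IsLocalRing R ↔ ∃! M : Ideal R, M.IsMaximal := by
  refine ⟨fun _ => existsUnique_isMaximal_of_isLocalRing, ?_⟩
  rintro ⟨M, hM, huniq⟩
  have : Nontrivial R := nontrivial_of_ne 1 0 fun h =>
    hM.ne_top ((Ideal.eq_top_iff_one M).mpr (h ▸ M.zero_mem))
  refine .of_isUnit_or_isUnit_one_sub_self fun a => ?_
  by_contra! h
  have ha : a ∈ M := by_contra fun ha => h.1 (isUnit_of_notMem hM huniq ha)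
  have ha' : 1 - a ∈ M := by_contra fun ha => h.2 (isUnit_of_notMem hM huniq ha)
  exact hM.ne_top ((Ideal.eq_top_iff_one M).mpr (by simpa using M.add_mem ha ha'))

end LocalRing

section NearRing

variable {N : Type*} [Zero N] [One N] [Add N] [Mul N] {R : Type*} [Ring R]

/-- A unital homomorphism from a loop near-ring onto a ring which reflects left invertibility. It
identifies the maximal `N`-subloops with the maximal left ideals. -/
structure IsReflectingEpi (ρ : N → R) : Prop where
  map_zero : ρ 0 = 0
  map_one : ρ 1 = 1
  map_add (a b : N) : ρ (a + b) = ρ a + ρ b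
  map_mul (a b : N) : ρ (a * b) = ρ a * ρ b
  surjective : Function.Surjective ρ
  mul_one (a : N) : a * 1 = a
  exists_mul_eq_one {a : N} (ha : IsUnit (ρ a)) : ∃ b, b * a = 1

namespace IsReflectingEpi

variable {ρ : N → R} (hρ : IsReflectingEpi ρ)
include hρ

theorem isNSubloop_preimage (I : Ideal R) : IsNSubloop (ρ ⁻¹' I) where
  zero_mem := by simp [hρ.map_zero]
  add_mem a ha b hb := by
    rw [Set.mem_preimage, hρ.map_add]
    exact I.add_mem ha hb
  left_diff_mem := by
    rintro a ha _ hb x rfl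
    rw [Set.mem_preimage, hρ.map_add] at hb
    exact (I.add_mem_iff_right ha).mp hb
  right_diff_mem := by
    rintro a ha _ hb x rfl
    rw [Set.mem_preimage, hρ.map_add] at hb
    exact (I.add_mem_iff_left ha).mp hb
  mul_mem n a ha := by
    rw [Set.mem_preimage, hρ.map_mul]
    exact I.mul_mem_left _ ha

theorem eq_univ {K : Set N} (hK : IsNSubloop K) {a : N} (haK : a ∈ K) (ha : IsUnit (ρ a)) :
    K = Set.univ := by
  obtain ⟨b, hb⟩ := hρ.exists_mul_eq_one ha
  exact Set.eq_univ_of_forall fun n => hρ.mul_one n ▸ hK.mul_mem n 1 (hb ▸ hK.mul_mem b a haK)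

theorem exists_ideal {K : Set N} (hK : IsNSubloop K) (hne : K ≠ Set.univ) :
    ∃ I : Ideal R, I ≠ ⊤ ∧ ρ '' K = I := by
  let I : Ideal R :=
    { carrier := ρ '' K
      zero_mem' := ⟨0, hK.zero_mem, hρ.map_zero⟩
      add_mem' := by
        rintro _ _ ⟨a, ha, rfl⟩ ⟨b, hb, rfl⟩
        exact ⟨a + b, hK.add_mem a ha b hb, hρ.map_add a b⟩
      smul_mem' := by
        rintro r _ ⟨a, ha, rfl⟩
        obtain ⟨n, rfl⟩ := hρ.surjective r
        exact ⟨n * a, hK.mul_mem n a ha, hρ.map_mul n a⟩ }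
  refine ⟨I, fun h => ?_, rfl⟩
  obtain ⟨a, ha, ha1⟩ := (Ideal.eq_top_iff_one I).mp h
  exact hne (hρ.eq_univ hK ha (ha1 ▸ isUnit_one))

theorem preimage_ne_univ {I : Ideal R} (hI : I ≠ ⊤) : ρ ⁻¹' I ≠ Set.univ := fun h =>
  hI <| (Ideal.eq_top_iff_one I).mpr <| hρ.map_one ▸ Set.eq_univ_iff_forall.mp h 1

theorem isMaximalNSubloop_iff {J : Set N} :
    IsMaximalNSubloop J ↔ ∃ M : Ideal R, M.IsMaximal ∧ ρ ⁻¹' M = J := by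
  constructor
  · rintro ⟨hJ, hne, hmax⟩
    obtain ⟨I, hI, hJI⟩ := hρ.exists_ideal hJ hne
    obtain ⟨M, hM, hIM⟩ := Ideal.exists_le_maximal I hI
    exact ⟨M, hM, hmax _ (hρ.isNSubloop_preimage M) (hρ.preimage_ne_univ hM.ne_top)
      (Set.image_subset_iff.mp (hJI.trans_subset hIM))⟩
  · rintro ⟨M, hM, rfl⟩
    refine ⟨hρ.isNSubloop_preimage M, hρ.preimage_ne_univ hM.ne_top, fun K hK hne hMK => ?_⟩
    obtain ⟨I, hI, hKI⟩ := hρ.exists_ideal hK hne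
    have hMI : (M : Set R) ⊆ I := by
      rw [← Set.image_preimage_eq (M : Set R) hρ.surjective, ← hKI]
      exact Set.image_mono hMK
    rw [hM.eq_of_le hI hMI]
    exact (Set.image_subset_iff.mp hKI.subset).antisymm (hM.eq_of_le hI hMI ▸ hMK)

theorem isLocalLoopNearRing_iff : IsLocalLoopNearRing N ↔ IsLocalRing R := by
  rw [isLocalRing_iff_existsUnique_isMaximal]
  have hinj : Function.Injective fun M : Ideal R => ρ ⁻¹' M := fun M M' h =>
    SetLike.coe_injective (hρ.surjective.preimage_injective h)
  simp only [IsLocalLoopNearRing, hρ.isMaximalNSubloop_iff]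
  constructor
  · rintro ⟨_, ⟨M, hM, rfl⟩, huniq⟩
    exact ⟨M, hM, fun M' hM' => hinj (huniq _ ⟨M', hM', rfl⟩)⟩
  · rintro ⟨M, hM, huniq⟩
    refine ⟨_, ⟨M, hM, rfl⟩, ?_⟩
    rintro _ ⟨M', hM', rfl⟩
    rw [huniq M' hM']

end IsReflectingEpi

end NearRing

namespace PtdSpace

open scoped unitInterval

noncomputable section

variable {X : PtdSpace.{u}} {Y : PtdSpace.{v}} {Z : PtdSpace.{w}}

/-! ### Iterated loop spaces -/

namespace Map

theorem ext {f g : Map X Y} (h : ∀ x, f.1 x = g.1 x) : f = g :=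
  Subtype.ext (ContinuousMap.ext h)

theorem Homotopic.refl (f : Map X Y) : f.Homotopic f := ContinuousMap.HomotopicRel.refl _

theorem Homotopic.symm {f g : Map X Y} (h : f.Homotopic g) : g.Homotopic f :=
  ContinuousMap.HomotopicRel.symm h

theorem Homotopic.trans {f g h : Map X Y} (h₁ : f.Homotopic g) (h₂ : g.Homotopic h) :
    f.Homotopic h :=
  ContinuousMap.HomotopicRel.trans h₁ h₂

theorem homotopic_iff {f g : Map X Y} : f.Homotopic g ↔
    ∃ F : I × X → Y, Continuous F ∧ (∀ x, F (0, x) = f.1 x) ∧ (∀ x, F (1, x) = g.1 x) ∧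
      ∀ s, F (s, X.pt) = Y.pt := by
  constructor
  · rintro ⟨F⟩
    exact ⟨F, F.continuous, F.apply_zero, F.apply_one, fun s => (F.eq_fst s rfl).trans f.2⟩
  · rintro ⟨F, hF, h0, h1, hpt⟩
    refine ⟨⟨⟨⟨F, hF⟩, h0, h1⟩, ?_⟩⟩
    rintro s x rfl
    exact (hpt s).trans f.2.symm

end Map

/-- The loop space of a pointed space, with the compact-open topology. -/
def loop (X : PtdSpace.{u}) : PtdSpace.{u} where
  carrier := Path X.pt X.pt
  pt := Path.refl X.pt

/-- Evaluation of loops. -/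
def loopEval (γ : X.loop) (s : I) : X := DFunLike.coe (F := Path X.pt X.pt) γ s

@[fun_prop]
theorem continuous_loopEval {T : Type*} [TopologicalSpace T] {γ : T → X.loop} {s : T → I}
    (hγ : Continuous γ) (hs : Continuous s) : Continuous fun t => loopEval (γ t) (s t) :=
  ((Path.continuous_uncurry_iff (g := fun γ : Path X.pt X.pt => γ)).2 continuous_id).comp
    (hγ.prodMk hs)

theorem loopEval_zero (γ : X.loop) : loopEval γ 0 = X.pt := Path.source _

theorem loopEval_one (γ : X.loop) : loopEval γ 1 = X.pt := Path.target _

theorem continuous_to_loop {T : Type*} [TopologicalSpace T] {g : T → Path X.pt X.pt}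
    (h : Continuous fun p : T × I => g p.1 p.2) : Continuous (g : T → X.loop) :=
  Path.continuous_uncurry_iff.1 h

namespace Map

/-- The image of a loop under a pointed map. -/
def mapPath (f : Map X Y) (γ : Path X.pt X.pt) : Path Y.pt Y.pt :=
  (γ.map f.1.continuous).cast f.2.symm f.2.symm

/-- The map of loop spaces induced by a pointed map. -/
def loop (f : Map X Y) : Map X.loop Y.loop :=
  ⟨⟨f.mapPath, continuous_to_loop <|
      show Continuous fun p : X.loop × I => f.1 (loopEval p.1 p.2) by fun_prop⟩,
    Path.ext (funext fun _ => f.2)⟩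

theorem Homotopic.loop {f g : Map X Y} (h : f.Homotopic g) : f.loop.Homotopic g.loop := by
  obtain ⟨F, hF, h0, h1, hpt⟩ := homotopic_iff.1 h
  refine homotopic_iff.2 ⟨fun p => (⟨⟨fun s => F (p.1, loopEval p.2 s), by fun_prop⟩,
    ?_, ?_⟩ : Path Y.pt Y.pt), continuous_to_loop ?_, ?_, ?_, ?_⟩
  · exact (congrArg (fun x => F (p.1, x)) (loopEval_zero p.2)).trans (hpt _)
  · exact (congrArg (fun x => F (p.1, x)) (loopEval_one p.2)).trans (hpt _)
  · change Continuous fun p : (I × X.loop) × I => F (p.1.1, loopEval p.1.2 p.2)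
    fun_prop
  · exact fun γ => Path.ext (funext fun s => h0 _)
  · exact fun γ => Path.ext (funext fun s => h1 _)
  · exact fun s => Path.ext (funext fun _ => hpt s)

end Map

namespace HStructure

theorem hmul_pt (H : HStructure X) : H.toHSpace.hmul (X.pt, X.pt) = X.pt := by
  have h := H.toHSpace.hmul_e_e
  rwa [H.e_eq] at h

theorem zero_add_homotopic (H : HStructure Y) (f : Map X Y) :
    (Map.add H (Map.zero X Y) f).Homotopic f := by
  refine Map.homotopic_iff.2 ⟨fun p => H.toHSpace.eHmul (p.1, f.1 p.2), by fun_prop,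
    fun x => ?_, fun x => H.toHSpace.eHmul.apply_one _, fun s => ?_⟩
  · refine (H.toHSpace.eHmul.apply_zero _).trans ?_
    simp [Map.add, Map.zero, H.e_eq]
  · exact (H.toHSpace.eHmul.eq_snd s (f.2.trans H.e_eq.symm)).trans f.2

theorem add_zero_homotopic (H : HStructure Y) (f : Map X Y) :
    (Map.add H f (Map.zero X Y)).Homotopic f := by
  refine Map.homotopic_iff.2 ⟨fun p => H.toHSpace.hmulE (p.1, f.1 p.2), by fun_prop,
    fun x => ?_, fun x => H.toHSpace.hmulE.apply_one _, fun s => ?_⟩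
  · refine (H.toHSpace.hmulE.apply_zero _).trans ?_
    simp [Map.add, Map.zero, H.e_eq]
  · exact (H.toHSpace.hmulE.eq_snd s (f.2.trans H.e_eq.symm)).trans f.2

/-- The H-structure given by a pointed multiplication for which the base point is a two-sided
homotopy unit. -/
def ofHomotopic (m : C(X × X, X)) (hm : m (X.pt, X.pt) = X.pt)
    (hl : Map.Homotopic (⟨m.comp ((ContinuousMap.const X X.pt).prodMk (ContinuousMap.id X)), hm⟩ :
      Map X X) (Map.id X))
    (hr : Map.Homotopic (⟨m.comp ((ContinuousMap.id X).prodMk (ContinuousMap.const X X.pt)), hm⟩ :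
      Map X X) (Map.id X)) : HStructure X where
  toHSpace :=
    { hmul := m
      e := X.pt
      hmul_e_e := hm
      eHmul := hl.some
      hmulE := hr.some }
  e_eq := rfl

/-- The pointwise product of two loops in an H-space. -/
def mulPath (H : HStructure X) (γ δ : Path X.pt X.pt) : Path X.pt X.pt :=
  ⟨⟨fun s => H.toHSpace.hmul (γ s, δ s), by fun_prop⟩, by simp [H.hmul_pt], by simp [H.hmul_pt]⟩

/-- The loop space of an H-space is an H-space under pointwise multiplication. -/
def loop (H : HStructure X) : HStructure X.loop :=
  ofHomotopic (X := X.loop)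
    ⟨fun p => H.mulPath p.1 p.2, continuous_to_loop <|
      show Continuous fun p : (X.loop × X.loop) × I =>
        H.toHSpace.hmul (loopEval p.1.1 p.2, loopEval p.1.2 p.2) by fun_prop⟩
    (Path.ext (funext fun _ => H.hmul_pt))
    (H.zero_add_homotopic (Map.id X)).loop (H.add_zero_homotopic (Map.id X)).loop

end HStructure

/-- The `n`-fold loop space. -/
def loopN : ℕ → PtdSpace.{u} → PtdSpace.{u}
  | 0, X => X
  | n + 1, X => loopN n X.loop

/-- The `n`-fold loop space of an H-space is an H-space. -/
def HStructure.loopN : ∀ (n : ℕ) {X : PtdSpace.{u}}, HStructure X → HStructure (X.loopN n)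
  | 0, _, H => H
  | n + 1, _, H => HStructure.loopN n H.loop

namespace Map

/-- The map of `n`-fold loop spaces induced by a pointed map. -/
def loopN : ∀ (n : ℕ) {X : PtdSpace.{u}} {Y : PtdSpace.{v}}, Map X Y →
    Map (X.loopN n) (Y.loopN n)
  | 0, _, _, f => f
  | n + 1, _, _, f => loopN n f.loop

theorem loopN_id (n : ℕ) (X : PtdSpace.{u}) : (Map.id X).loopN n = Map.id (X.loopN n) := by
  induction n generalizing X with
  | zero => rfl
  | succ _ ih => exact ih X.loop

theorem loopN_comp (n : ℕ) {X : PtdSpace.{u}} {Y : PtdSpace.{v}} {Z : PtdSpace.{w}}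
    (g : Map Y Z) (f : Map X Y) : (g.comp f).loopN n = (g.loopN n).comp (f.loopN n) := by
  induction n generalizing X Y Z with
  | zero => rfl
  | succ _ ih => exact ih g.loop f.loop

theorem loopN_zero (n : ℕ) (X : PtdSpace.{u}) (Y : PtdSpace.{v}) :
    (Map.zero X Y).loopN n = Map.zero (X.loopN n) (Y.loopN n) := by
  induction n generalizing X Y with
  | zero => rfl
  | succ _ ih => exact ih X.loop Y.loop

theorem loopN_add (n : ℕ) {X : PtdSpace.{u}} {Y : PtdSpace.{v}} (H : HStructure Y)
    (f g : Map X Y) : (Map.add H f g).loopN n = Map.add (H.loopN n) (f.loopN n) (g.loopN n) := by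
  induction n generalizing X Y with
  | zero => rfl
  | succ _ ih => exact ih H.loop f.loop g.loop

theorem Homotopic.loopN (n : ℕ) {X : PtdSpace.{u}} {Y : PtdSpace.{v}} {f g : Map X Y}
    (h : f.Homotopic g) : (f.loopN n).Homotopic (g.loopN n) := by
  induction n generalizing X Y with
  | zero => exact h
  | succ _ ih => exact ih h.loop

end Map

/-! ### Homotopy groups -/

/-- The fundamental group of a pointed space. -/
abbrev pi1 (X : PtdSpace.{u}) : Type u := FundamentalGroup X X.pt

namespace pi1

/-- The class of a loop in the fundamental group. -/
def mk (γ : Path X.pt X.pt) : pi1 X := Path.Homotopic.Quotient.mk γ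

theorem mk_surjective : Function.Surjective (mk : Path X.pt X.pt → pi1 X) :=
  Path.Homotopic.Quotient.mk_surjective

theorem mk_eq {γ δ : Path X.pt X.pt} : mk γ = mk δ ↔ γ.Homotopic δ :=
  Path.Homotopic.Quotient.eq

end pi1

namespace Map

/-- The homomorphism of fundamental groups induced by a pointed map. -/
def pi1 (f : Map X Y) : pi1 X →* pi1 Y := FundamentalGroup.mapOfEq f.1 f.2

theorem pi1_mk (f : Map X Y) (γ : Path X.pt X.pt) : f.pi1 (pi1.mk γ) = pi1.mk (f.mapPath γ) :=
  FundamentalGroup.mapOfEq_apply f.1 f.2 _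

theorem pi1_id : (Map.id X).pi1 = MonoidHom.id _ := by
  ext a
  obtain ⟨γ, rfl⟩ := pi1.mk_surjective a
  exact pi1_mk _ _

theorem pi1_comp (g : Map Y Z) (f : Map X Y) : (g.comp f).pi1 = g.pi1.comp f.pi1 := by
  ext a
  obtain ⟨γ, rfl⟩ := pi1.mk_surjective a
  simp only [MonoidHom.comp_apply, pi1_mk]
  rfl

theorem pi1_zero : (Map.zero X Y).pi1 = 1 := by
  ext a
  obtain ⟨γ, rfl⟩ := pi1.mk_surjective a
  exact pi1_mk _ _

theorem Homotopic.pi1 {f g : Map X Y} (h : f.Homotopic g) : f.pi1 = g.pi1 := by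
  ext a
  obtain ⟨γ, rfl⟩ := pi1.mk_surjective a
  rw [pi1_mk, pi1_mk, pi1.mk_eq]
  obtain ⟨F, hF, h0, h1, hpt⟩ := homotopic_iff.1 h
  refine ⟨⟨⟨⟨fun p => F (p.1, γ p.2), by fun_prop⟩, fun s => h0 _, fun s => h1 _⟩, ?_⟩⟩
  rintro s x (rfl | rfl) <;> simp [hpt]

end Map

namespace HStructure

theorem mulPath_trans (H : HStructure X) (γ γ' δ δ' : Path X.pt X.pt) :
    H.mulPath (γ.trans γ') (δ.trans δ') = (H.mulPath γ δ).trans (H.mulPath γ' δ') := by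
  ext s
  simp only [mulPath, Path.trans_apply, Path.coe_mk', ContinuousMap.coe_mk]
  split_ifs <;> rfl

theorem mulPath_homotopic (H : HStructure X) {γ γ' δ δ' : Path X.pt X.pt}
    (hγ : γ.Homotopic γ') (hδ : δ.Homotopic δ') :
    (H.mulPath γ δ).Homotopic (H.mulPath γ' δ') := by
  obtain ⟨F⟩ := hγ
  obtain ⟨G⟩ := hδ
  refine ⟨⟨⟨⟨fun p => H.toHSpace.hmul (F p, G p), by fun_prop⟩, ?_, ?_⟩, ?_⟩⟩
  · simp [mulPath]
  · simp [mulPath]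
  · rintro s x (rfl | rfl) <;> simp [mulPath]

/-- The operation on the fundamental group of an H-space induced by the multiplication. -/
def pi1Mul (H : HStructure X) : pi1 X → pi1 X → pi1 X :=
  Quotient.map₂ H.mulPath fun _ _ hγ _ _ hδ => H.mulPath_homotopic hγ hδ

theorem isUnital_pi1Mul (H : HStructure X) : EckmannHilton.IsUnital H.pi1Mul 1 where
  left_id a := by
    obtain ⟨γ, rfl⟩ := pi1.mk_surjective a
    have h := DFunLike.congr_fun (H.zero_add_homotopic (Map.id X)).pi1 (pi1.mk γ)
    rwa [Map.pi1_mk, Map.pi1_mk] at h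
  right_id a := by
    obtain ⟨γ, rfl⟩ := pi1.mk_surjective a
    have h := DFunLike.congr_fun (H.add_zero_homotopic (Map.id X)).pi1 (pi1.mk γ)
    rwa [Map.pi1_mk, Map.pi1_mk] at h

theorem pi1Mul_mul_mul (H : HStructure X) (a b c d : pi1 X) :
    H.pi1Mul (a * b) (c * d) = H.pi1Mul a c * H.pi1Mul b d := by
  obtain ⟨α, rfl⟩ := pi1.mk_surjective a
  obtain ⟨β, rfl⟩ := pi1.mk_surjective b
  obtain ⟨γ, rfl⟩ := pi1.mk_surjective c
  obtain ⟨δ, rfl⟩ := pi1.mk_surjective d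
  exact congrArg pi1.mk (H.mulPath_trans β α δ γ)

theorem pi1Mul_eq_mul (H : HStructure X) : H.pi1Mul = (· * ·) :=
  EckmannHilton.mul H.isUnital_pi1Mul EckmannHilton.MulOneClass.isUnital H.pi1Mul_mul_mul

theorem pi1_mul_comm (H : HStructure X) (a b : pi1 X) : a * b = b * a :=
  (EckmannHilton.mul_comm H.isUnital_pi1Mul EckmannHilton.MulOneClass.isUnital
    H.pi1Mul_mul_mul).comm a b

end HStructure

theorem Map.pi1_add (H : HStructure Y) (f g : Map X Y) (a : X.pi1) :
    (Map.add H f g).pi1 a = f.pi1 a * g.pi1 a := by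
  obtain ⟨γ, rfl⟩ := pi1.mk_surjective a
  simp only [Map.pi1_mk]
  exact congrFun₂ H.pi1Mul_eq_mul (pi1.mk (f.mapPath γ)) (pi1.mk (g.mapPath γ))

/-- The product of all homotopy groups of positive degree of a pointed space, written additively. -/
def TotalPi (X : PtdSpace.{u}) : Type u := ∀ n : ℕ, Additive (X.loopN n).pi1

instance : AddGroup X.TotalPi := inferInstanceAs (AddGroup (∀ n : ℕ, Additive (X.loopN n).pi1))

/-- `X` admits an H-structure. -/
class IsH (X : PtdSpace.{u}) : Prop where
  nonempty : Nonempty X.HStructure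

instance [h : IsH X] : AddCommGroup X.TotalPi where
  add_comm a b := by
    obtain ⟨H⟩ := h.nonempty
    exact funext fun n => (H.loopN n).pi1_mul_comm (a n) (b n)

namespace Map

/-- The homomorphism of homotopy groups induced by a pointed map. -/
def totalPi (f : Map X Y) : X.TotalPi →+ Y.TotalPi where
  toFun := Pi.map fun n => (f.loopN n).pi1.toAdditive
  map_zero' := funext fun n => (f.loopN n).pi1.map_one
  map_add' a b := funext fun n => (f.loopN n).pi1.map_mul (a n).toMul (b n).toMul

theorem totalPi_apply (f : Map X Y) (a : X.TotalPi) (n : ℕ) :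
    f.totalPi a n = Additive.ofMul ((f.loopN n).pi1 (a n).toMul) := rfl

theorem totalPi_id : (Map.id X).totalPi = AddMonoidHom.id _ := by
  ext a
  funext n
  rw [totalPi_apply, loopN_id, pi1_id]
  rfl

theorem totalPi_comp (g : Map Y Z) (f : Map X Y) :
    (g.comp f).totalPi = g.totalPi.comp f.totalPi := by
  ext a
  funext n
  rw [totalPi_apply, loopN_comp, pi1_comp]
  rfl

theorem totalPi_zero : (Map.zero X Y).totalPi = 0 := by
  ext a
  funext n
  rw [totalPi_apply, loopN_zero, pi1_zero]
  rfl

theorem Homotopic.totalPi {f g : Map X Y} (h : f.Homotopic g) : f.totalPi = g.totalPi := by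
  ext a
  funext n
  rw [totalPi_apply, (h.loopN n).pi1]
  rfl

theorem totalPi_add [IsH Y] (H : HStructure Y) (f g : Map X Y) :
    (Map.add H f g).totalPi = f.totalPi + g.totalPi := by
  ext a
  funext n
  rw [totalPi_apply, loopN_add, pi1_add]
  rfl

theorem bijective_pi1_of_totalPi {f : Map X Y} (h : Function.Bijective f.totalPi) (n : ℕ) :
    Function.Bijective (f.loopN n).pi1 := by
  refine ⟨Pi.map_injective (f := fun k => (f.loopN k).pi1.toAdditive).mp h.1 n, fun b => ?_⟩
  obtain ⟨a, ha⟩ := h.2 (Function.update (0 : Y.TotalPi) n (Additive.ofMul b))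
  exact ⟨(a n).toMul, (congrFun ha n).trans (Function.update_self n _ _)⟩

end Map

end

end PtdSpace

/-! ### Mapping path spaces and homotopy fibres -/

section MappingPath

open scoped unitInterval

variable {A : Type u} {B : Type v} [TopologicalSpace A] [TopologicalSpace B]

/-- The mapping path space of `f : A → B`: the pairs of a point `a : A` and a path in `B` which
starts at `f a`. -/
def MappingPath (f : C(A, B)) : Type (max u v) := {p : A × C(I, B) // p.2 0 = f p.1}

namespace MappingPath

variable {f : C(A, B)}

instance : TopologicalSpace (MappingPath f) := instTopologicalSpaceSubtype

/-- The point of `A` underlying a point of the mapping path space. -/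
def fst (z : MappingPath f) : A := z.1.1

/-- The path in `B` underlying a point of the mapping path space. -/
def path (z : MappingPath f) : C(I, B) := z.1.2

/-- The endpoint projection of the mapping path space. -/
def last (z : MappingPath f) : B := z.path 1

theorem path_zero (z : MappingPath f) : z.path 0 = f z.fst := z.2

theorem ext {z z' : MappingPath f} (h : z.fst = z'.fst) (h' : ∀ s, z.path s = z'.path s) :
    z = z' :=
  Subtype.ext (Prod.ext h (ContinuousMap.ext h'))

@[fun_prop]
theorem continuous_fst : Continuous (fst : MappingPath f → A) :=
  _root_.continuous_fst.comp continuous_subtype_val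

@[fun_prop]
theorem continuous_path : Continuous (path : MappingPath f → C(I, B)) :=
  continuous_snd.comp continuous_subtype_val

theorem continuous_mk {T : Type*} [TopologicalSpace T] {a : T → A} {γ : T → C(I, B)}
    (h : ∀ t, γ t 0 = f (a t)) (ha : Continuous a) (hγ : Continuous fun p : T × I => γ p.1 p.2) :
    Continuous fun t => (⟨(a t, γ t), h t⟩ : MappingPath f) :=
  (ha.prodMk (ContinuousMap.continuous_of_continuous_uncurry γ hγ)).subtype_mk _

/-- The endpoint projection is a Hurewicz fibration: prolong the path of `z p` by `β (p, ·)`. -/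
theorem exists_lift_homotopy {P : Type*} [TopologicalSpace P] (z : C(P, MappingPath f))
    (β : C(P × ℝ, B)) (hβ : ∀ p, β (p, 0) = (z p).last) :
    ∃ H : C(P × ℝ, MappingPath f), (∀ p, H (p, 0) = z p) ∧
      ∀ p τ, 0 ≤ τ → (H (p, τ)).last = β (p, τ) := by
  let γ (q : (P × ℝ) × I) : B :=
    if q.2 * (1 + |q.1.2|) ≤ 1 then (z q.1.1).path
      (Set.projIcc 0 1 zero_le_one (q.2 * (1 + |q.1.2|)))
    else β (q.1.1, q.2 * (1 + |q.1.2|) - 1)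
  have hγ : Continuous γ := by
    refine Continuous.if_le (by fun_prop) (by fun_prop) (by fun_prop) (by fun_prop) fun q hq => ?_
    rw [hq, Set.projIcc_right, sub_self, hβ]
    rfl
  have hstart : ∀ q, γ (q, 0) = f (z q.1).fst := by simp [γ, path_zero]
  refine ⟨⟨fun q => ⟨((z q.1).fst, ⟨fun s => γ (q, s), by fun_prop⟩), hstart q⟩,
    continuous_mk hstart (by fun_prop) hγ⟩, fun p => ext rfl fun s => ?_, fun p τ hτ => ?_⟩
  · have hs : (s : ℝ) ≤ 1 := s.2.2
    change γ ((p, 0), s) = _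
    simp [γ, hs]
  · change γ ((p, τ), 1) = _
    rcases hτ.eq_or_lt with rfl | hτ
    · simp [γ, hβ, last]
    · simp [γ, abs_of_pos hτ, hτ.not_ge]

end MappingPath

end MappingPath

namespace PtdSpace

open scoped unitInterval

noncomputable section

variable {A : PtdSpace.{u}} {B : PtdSpace.{v}}

/-- The homotopy fibre of a pointed map: the fibre of the endpoint projection of its mapping path
space. -/
def hfib (f : Map A B) : PtdSpace.{max u v} where
  carrier := {z : MappingPath f.1 // z.last = B.pt}
  pt := ⟨⟨(A.pt, ContinuousMap.const I B.pt), f.2.symm⟩, rfl⟩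

namespace hfib

variable {f : Map A B}

/-- The point of the homotopy fibre given by a point of `A` and a path from its image to the base
point. -/
def mk (a : A) (γ : Path (f.1 a) B.pt) : hfib f := ⟨⟨(a, γ.toContinuousMap), γ.source⟩, γ.target⟩

/-- The point of `A` underlying a point of the homotopy fibre. -/
def fst (z : hfib f) : A := z.1.fst

/-- The path in `B` underlying a point of the homotopy fibre. -/
def path (z : hfib f) : Path (f.1 (fst z)) B.pt := ⟨z.1.path, z.1.path_zero, z.2⟩

theorem ext {z z' : hfib f} (h : fst z = fst z') (h' : ∀ s, path z s = path z' s) : z = z' :=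
  Subtype.ext (MappingPath.ext h h')

@[fun_prop]
theorem continuous_fst : Continuous (fst : hfib f → A) :=
  MappingPath.continuous_fst.comp continuous_subtype_val

@[fun_prop]
theorem continuous_path {T : Type*} [TopologicalSpace T] {z : T → hfib f} {s : T → I}
    (hz : Continuous z) (hs : Continuous s) : Continuous fun t => path (z t) (s t) := by
  have : Continuous fun t => (z t).1 := continuous_subtype_val.comp hz
  change Continuous fun t => (z t).1.path (s t)
  fun_prop

theorem continuous_mk {T : Type*} [TopologicalSpace T] {a : T → A}
    {γ : ∀ t, Path (f.1 (a t)) B.pt} (ha : Continuous a)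
    (hγ : Continuous fun p : T × I => γ p.1 p.2) : Continuous fun t => mk (a t) (γ t) :=
  (MappingPath.continuous_mk (fun t => (γ t).source) ha hγ).subtype_mk _

theorem joined_of_homotopic {a : A} {γ δ : Path (f.1 a) B.pt} (h : γ.Homotopic δ) :
    Joined (mk a γ) (mk a δ) := by
  obtain ⟨G⟩ := h
  refine ⟨⟨⟨fun s => mk a (G.eval s), continuous_mk continuous_const G.continuous⟩, ?_, ?_⟩⟩
  · simp
  · simp

theorem joined_mk_map {a : A} (δ : Path a A.pt) :
    Joined (mk a ((δ.map f.1.continuous).cast rfl f.2.symm)) (hfib f).pt := by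
  have hsup : Continuous fun p : I × I => f.1 (δ (p.1 ⊔ p.2)) := by fun_prop
  have htarget : f.1 (δ 1) = B.pt := (congrArg f.1 δ.target).trans f.2
  refine ⟨⟨⟨fun s => mk (δ s) ⟨⟨fun r => f.1 (δ (s ⊔ r)), by fun_prop⟩, ?_, ?_⟩,
    continuous_mk δ.continuous hsup⟩, ext δ.source fun r => ?_, ext δ.target fun r => ?_⟩⟩
  · exact congrArg (fun t => f.1 (δ t)) (sup_of_le_left s.2.1)
  · exact (congrArg (fun t => f.1 (δ t)) (sup_of_le_right s.2.2)).trans htarget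
  · exact congrArg (fun t => f.1 (δ t)) (sup_of_le_right r.2.1)
  · exact (congrArg (fun t => f.1 (δ t)) (sup_of_le_left r.2.2)).trans htarget

theorem joined_pt (hinj : ∀ a, Joined (f.1 a) B.pt → Joined a A.pt)
    (hsurj : Function.Surjective f.pi1) (z : hfib f) : Joined z (hfib f).pt := by
  obtain ⟨ν⟩ := hinj (fst z) ⟨path z⟩
  let fν : Path (f.1 (fst z)) B.pt := (ν.map f.1.continuous).cast rfl f.2.symm
  obtain ⟨b, hb⟩ := hsurj (pi1.mk (fν.symm.trans (path z)))
  obtain ⟨β, rfl⟩ := pi1.mk_surjective b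
  rw [Map.pi1_mk, pi1.mk_eq] at hb
  have hmap : ((ν.trans β).map f.1.continuous).cast rfl f.2.symm = fν.trans (f.mapPath β) := by
    ext s
    simp only [fν, Map.mapPath, Path.cast_coe, Path.map_coe, Function.comp, Path.trans_apply]
    split_ifs <;> rfl
  have hpath : (fν.trans (f.mapPath β)).Homotopic (path z) :=
    (((Path.Homotopic.refl fν).hcomp hb).trans (Path.Homotopic.trans_assoc _ _ _).symm).trans
      (((Path.Homotopic.trans_symm fν).hcomp (Path.Homotopic.refl _)).trans
        (Path.Homotopic.refl_trans _))
  exact (joined_of_homotopic (hmap ▸ hpath.symm)).trans (joined_mk_map (ν.trans β))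

variable (f) in
/-- A loop in the homotopy fibre, as a point of the homotopy fibre of the loop map. -/
def ofLoop : Map (hfib f).loop (hfib f.loop) where
  val :=
    { toFun := fun ω => mk
        (⟨⟨fun s => fst (loopEval ω s), by fun_prop⟩, congrArg fst (loopEval_zero ω),
          congrArg fst (loopEval_one ω)⟩ : Path A.pt A.pt)
        ⟨⟨fun r => (⟨⟨fun s => path (loopEval ω s) r, by fun_prop⟩,
            congrArg (fun z => path z r) (loopEval_zero ω),
            congrArg (fun z => path z r) (loopEval_one ω)⟩ : Path B.pt B.pt),
          continuous_to_loop <| show Continuous fun p : I × I => path (loopEval ω p.2) p.1 by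
            fun_prop⟩,
          Path.ext (funext fun s => (path (loopEval ω s)).source),
          Path.ext (funext fun s => (path (loopEval ω s)).target)⟩
      continuous_toFun := continuous_mk
        (continuous_to_loop <| show Continuous fun p : (hfib f).loop × I =>
          fst (loopEval p.1 p.2) by fun_prop)
        (continuous_to_loop <| show Continuous fun p : ((hfib f).loop × I) × I =>
          path (loopEval p.1.1 p.2) p.1.2 by fun_prop) }
  property := rfl

variable (f) in
/-- A point of the homotopy fibre of the loop map, as a loop in the homotopy fibre. -/
def toLoop : Map (hfib f.loop) (hfib f).loop where
  val :=
    { toFun := fun z => (⟨⟨fun s => mk (loopEval (fst z) s)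
          ⟨⟨fun r => loopEval (path z r) s, by fun_prop⟩,
            congrArg (loopEval · s) (path z).source, congrArg (loopEval · s) (path z).target⟩,
          continuous_mk (by fun_prop) <| show Continuous fun p : I × I =>
            loopEval (path z p.2) p.1 by fun_prop⟩,
        ext (loopEval_zero (fst z)) fun r => loopEval_zero (path z r),
        ext (loopEval_one (fst z)) fun r => loopEval_one (path z r)⟩ :
          Path (hfib f).pt (hfib f).pt)
      continuous_toFun := continuous_to_loop <| continuous_mk
        (show Continuous fun p : hfib f.loop × I => loopEval (fst p.1) p.2 by fun_prop) <|
        show Continuous fun p : (hfib f.loop × I) × I => loopEval (path p.1.1 p.2) p.1.2 by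
          fun_prop }
  property := rfl

variable (f) in
theorem toLoop_comp_ofLoop : (toLoop f).comp (ofLoop f) = Map.id _ := rfl

end hfib

/-- All iterated loop spaces of `W` are path-connected. -/
def IsWeaklyContractible (W : PtdSpace.{u}) : Prop :=
  ∀ (k : ℕ) (z : W.loopN k), Joined z (W.loopN k).pt

theorem joined_loopN_of_comp_eq_id {i : Map A B} {p : Map B A} (h : p.comp i = Map.id A) {k : ℕ}
    (hB : ∀ z : B.loopN k, Joined z (B.loopN k).pt) (z : A.loopN k) :
    Joined z (A.loopN k).pt := by
  have hz : (p.loopN k).1 ((i.loopN k).1 z) = z := by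
    have hk : (p.loopN k).comp (i.loopN k) = Map.id _ := by rw [← Map.loopN_comp, h, Map.loopN_id]
    exact congrArg (fun m : Map _ _ => m.1 z) hk
  obtain ⟨γ⟩ := hB ((i.loopN k).1 z)
  exact ⟨(γ.map (p.loopN k).1.continuous).cast hz.symm (p.loopN k).2.symm⟩

/-- The loops in a product, as points of the product of the loop spaces. -/
def loopToPi {ι : Type w} (F : ι → PtdSpace.{v}) : Map (pi F).loop (pi fun i => (F i).loop) where
  val :=
    { toFun := fun ω i => (⟨⟨fun s => (loopEval ω s : ∀ i, F i) i,
          (continuous_apply i).comp (continuous_loopEval continuous_const continuous_id)⟩,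
        congrFun (loopEval_zero ω) i, congrFun (loopEval_one ω) i⟩ : Path (F i).pt (F i).pt)
      continuous_toFun := continuous_pi fun i => continuous_to_loop <|
        show Continuous fun p : (pi F).loop × I => (loopEval p.1 p.2 : ∀ i, F i) i from
          (continuous_apply i).comp
            (continuous_loopEval _root_.continuous_fst continuous_snd) }
  property := rfl

/-- The families of loops, as loops in the product. -/
def piToLoop {ι : Type w} (F : ι → PtdSpace.{v}) : Map (pi fun i => (F i).loop) (pi F).loop where
  val :=
    { toFun := fun ω => (⟨⟨fun s i => loopEval (ω i) s, by fun_prop⟩,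
        funext fun i => loopEval_zero (ω i), funext fun i => loopEval_one (ω i)⟩ :
          Path (pi F).pt (pi F).pt)
      continuous_toFun := continuous_to_loop <| continuous_pi fun i =>
        continuous_loopEval ((continuous_apply i).comp _root_.continuous_fst) continuous_snd }
  property := rfl

theorem piToLoop_comp_loopToPi {ι : Type w} (F : ι → PtdSpace.{v}) :
    (piToLoop F).comp (loopToPi F) = Map.id _ := rfl

namespace IsWeaklyContractible

theorem pi {ι : Type w} {F : ι → PtdSpace.{v}} (h : ∀ i, (F i).IsWeaklyContractible) :
    (pi F).IsWeaklyContractible := by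
  intro k
  induction k generalizing F with
  | zero =>
    exact fun z => ⟨Path.pi fun i => (h i 0 (z i)).somePath⟩
  | succ k ih =>
    exact joined_loopN_of_comp_eq_id (piToLoop_comp_loopToPi F) (ih fun i j => h i (j + 1))

end IsWeaklyContractible

theorem pi1.mk_eq_one_iff_joined {γ : A.loop} :
    pi1.mk (X := A) γ = 1 ↔ Joined γ A.loop.pt := by
  refine (pi1.mk_eq (δ := Path.refl A.pt)).trans ⟨?_, ?_⟩
  · rintro ⟨G⟩
    exact ⟨⟨⟨G.eval, continuous_to_loop G.continuous⟩, G.eval_zero, G.eval_one⟩⟩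
  · rintro ⟨p⟩
    refine ⟨⟨⟨⟨fun q => loopEval (p q.1) q.2, by fun_prop⟩, ?_, ?_⟩, ?_⟩⟩
    · exact fun s => congrArg (loopEval · s) p.source
    · exact fun s => congrArg (loopEval · s) p.target
    · rintro s x (rfl | rfl)
      · exact (loopEval_zero (p s)).trans (loopEval_zero γ).symm
      · exact (loopEval_one (p s)).trans (loopEval_one γ).symm

/-- `f` is a weak homotopy equivalence onto the path component of the base point: it reflects the
path component of the base point of all iterated loop spaces, and is surjective on homotopy groups
of positive degree. -/
def Map.IsWeakEquiv (f : Map A B) : Prop :=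
  ∀ k : ℕ, (∀ a, Joined ((f.loopN k).1 a) (B.loopN k).pt → Joined a (A.loopN k).pt) ∧
    Function.Surjective (f.loopN k).pi1

theorem IsWeaklyContractible.isWeakEquiv (hA : A.IsWeaklyContractible)
    (hB : B.IsWeaklyContractible) (f : Map A B) : f.IsWeakEquiv := by
  refine fun k => ⟨fun a _ => hA k a, ?_⟩
  induction k generalizing A B with
  | zero =>
    intro b
    obtain ⟨γ, rfl⟩ := pi1.mk_surjective b
    exact ⟨1, (map_one f.pi1).trans (pi1.mk_eq_one_iff_joined.2 (hB 1 γ)).symm⟩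
  | succ _ ih => exact ih (fun j => hA (j + 1)) (fun j => hB (j + 1)) f.loop

theorem Map.IsWeakEquiv.hfib {f : Map A B} (h : f.IsWeakEquiv) :
    (hfib f).IsWeaklyContractible := by
  intro k
  induction k generalizing A B with
  | zero => exact hfib.joined_pt (h 0).1 (h 0).2
  | succ k ih =>
    exact joined_loopN_of_comp_eq_id (hfib.toLoop_comp_ofLoop f) (ih fun j => h (j + 1))

theorem Map.joined_of_injective_pi1 (f : Map A B) {k : ℕ}
    (h : Function.Injective (f.loopN k).pi1) (a : A.loopN (k + 1))
    (ha : Joined ((f.loopN (k + 1)).1 a) (B.loopN (k + 1)).pt) :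
    Joined a (A.loopN (k + 1)).pt := by
  induction k generalizing A B with
  | zero =>
    have hfa : f.pi1 (pi1.mk a) = 1 :=
      (Map.pi1_mk f a).trans (pi1.mk_eq_one_iff_joined.2 ha)
    exact pi1.mk_eq_one_iff_joined.1 (h (hfa.trans (map_one f.pi1).symm))
  | succ k ih => exact ih f.loop h a ha

theorem Map.isWeakEquiv_of_bijective_totalPi [PathConnectedSpace A] {f : Map A B}
    (h : Function.Bijective f.totalPi) : f.IsWeakEquiv := by
  refine fun k => ⟨?_, (Map.bijective_pi1_of_totalPi h k).2⟩
  cases k with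
  | zero => exact fun a _ => PathConnectedSpace.joined (X := A) a A.pt
  | succ k => exact f.joined_of_injective_pi1 (Map.bijective_pi1_of_totalPi h k).1

end

end PtdSpace

/-! ### Extending maps from spheres to balls -/

section BallExtension

open scoped unitInterval
open Metric

noncomputable section

variable {E : Type*} [NormedAddCommGroup E]

variable (E) in
/-- The inclusion of the unit sphere into the closed unit ball. -/
def sphereToBall : C(sphere (0 : E) 1, closedBall (0 : E) 1) :=
  ⟨Set.inclusion sphere_subset_closedBall, continuous_inclusion sphere_subset_closedBall⟩

theorem norm_sphereToBall (θ : sphere (0 : E) 1) : ‖(sphereToBall E θ : E)‖ = 1 :=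
  norm_eq_of_mem_sphere θ

theorem norm_le_one (x : closedBall (0 : E) 1) : ‖(x : E)‖ ≤ 1 := mem_closedBall_zero_iff.1 x.2

variable (E) in
/-- The extension property of `W` with respect to the inclusion of the unit sphere of `E` into the
closed unit ball. -/
def HasBallExtension (W : Type*) [TopologicalSpace W] : Prop :=
  ∀ g : C(sphere (0 : E) 1, W), ∃ G : C(closedBall (0 : E) 1, W), ∀ θ, G (sphereToBall E θ) = g θ

variable (E) in
/-- The lifting property of `p` with respect to the inclusion of the unit sphere of `E` into the
closed unit ball. -/
def HasBallLifting {T B : Type*} [TopologicalSpace T] [TopologicalSpace B] (p : T → B) : Prop :=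
  ∀ (k : C(closedBall (0 : E) 1, B)) (g : C(sphere (0 : E) 1, T)),
    (∀ θ, p (g θ) = k (sphereToBall E θ)) →
      ∃ G : C(closedBall (0 : E) 1, T), (∀ θ, G (sphereToBall E θ) = g θ) ∧ ∀ x, p (G x) = k x

theorem continuous_of_restrict_le {T W : Type*} [TopologicalSpace T] [TopologicalSpace W]
    {a b : T → ℝ} (ha : Continuous a) (hb : Continuous b) {f : T → W}
    (hab : Continuous fun x : {x // a x ≤ b x} => f x)
    (hba : Continuous fun x : {x // b x ≤ a x} => f x) : Continuous f :=
  continuousOn_univ.1 <| ((continuousOn_iff_continuous_domRestrict.2 hab).union_of_isClosed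
    (continuousOn_iff_continuous_domRestrict.2 hba) (isClosed_le ha hb) (isClosed_le hb ha)).mono
    fun x _ => le_total (a x) (b x)

theorem ne_zero_of_half_le {x : E} (hx : 1 / 2 ≤ ‖x‖) : x ≠ 0 :=
  norm_pos_iff.1 (by linarith)

section Scale

variable [NormedSpace ℝ E]

/-- Scaling of the closed unit ball by a factor in the unit interval. -/
def scaleBall (c : I) (x : closedBall (0 : E) 1) : closedBall (0 : E) 1 :=
  ⟨(c : ℝ) • (x : E), by
    rw [mem_closedBall_zero_iff, norm_smul, Real.norm_of_nonneg c.2.1]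
    exact mul_le_one₀ c.2.2 (norm_nonneg _) (norm_le_one x)⟩

@[fun_prop]
theorem continuous_scaleBall {T : Type*} [TopologicalSpace T] {c : T → I}
    {x : T → closedBall (0 : E) 1} (hc : Continuous c) (hx : Continuous x) :
    Continuous fun t => scaleBall (c t) (x t) := by
  unfold scaleBall
  fun_prop

theorem scaleBall_one (x : closedBall (0 : E) 1) : scaleBall 1 x = x := Subtype.ext (one_smul ℝ _)

theorem scaleBall_zero (x : closedBall (0 : E) 1) :
    scaleBall 0 x = ⟨0, mem_closedBall_self zero_le_one⟩ := Subtype.ext (zero_smul ℝ _)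

variable {W : Type*} [TopologicalSpace W]

/-- The radial projection of a non-zero vector to the unit sphere. -/
def radial (x : E) (hx : x ≠ 0) : sphere (0 : E) 1 :=
  ⟨‖x‖⁻¹ • x, mem_sphere_zero_iff_norm.2 (norm_smul_inv_norm (𝕜 := ℝ) hx)⟩

theorem radial_sphereToBall (θ : sphere (0 : E) 1) (h : (sphereToBall E θ : E) ≠ 0) :
    radial _ h = θ :=
  Subtype.ext (by simp [radial, sphereToBall])

theorem continuous_radial {T : Type*} [TopologicalSpace T] {x : T → E} (hx : Continuous x)
    (h0 : ∀ t, x t ≠ 0) : Continuous fun t => radial (x t) (h0 t) :=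
  Continuous.subtype_mk ((hx.norm.inv₀ fun t => norm_ne_zero_iff.2 (h0 t)).smul hx) _

theorem exists_glue_shell (H : C(sphere (0 : E) 1 × ℝ, W)) (G : C(closedBall (0 : E) 1, W))
    (h : ∀ θ, G (sphereToBall E θ) = H (θ, 1 / 2)) :
    ∃ F : C(closedBall (0 : E) 1, W),
      (∀ (x : closedBall (0 : E) 1) (hx : 1 / 2 ≤ ‖(x : E)‖),
        F x = H (radial x.1 (ne_zero_of_half_le hx), 1 - ‖(x : E)‖)) ∧
      ∀ x : closedBall (0 : E) 1, ‖(x : E)‖ ≤ 1 / 2 → ∃ y, F x = G y := by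
  let inner (x : E) (hx : ‖x‖ ≤ 1 / 2) : closedBall (0 : E) 1 :=
    ⟨(2 : ℝ) • x, by rw [mem_closedBall_zero_iff, norm_smul, Real.norm_two]; linarith⟩
  let F (x : closedBall (0 : E) 1) : W :=
    if hx : 1 / 2 ≤ ‖(x : E)‖ then H (radial x.1 (ne_zero_of_half_le hx), 1 - ‖(x : E)‖)
    else G (inner x (not_le.1 hx).le)
  have hF_outer (x : closedBall (0 : E) 1) (hx : 1 / 2 ≤ ‖(x : E)‖) :
      F x = H (radial x.1 (ne_zero_of_half_le hx), 1 - ‖(x : E)‖) := dif_pos hx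
  have hF_inner (x : closedBall (0 : E) 1) (hx : ‖(x : E)‖ ≤ 1 / 2) : F x = G (inner x hx) := by
    rcases hx.lt_or_eq with hlt | heq
    · exact dif_neg hlt.not_ge
    · have hsphere : sphereToBall E (radial x.1 (ne_zero_of_half_le heq.ge)) = inner x hx :=
        Subtype.ext (by simp [sphereToBall, radial, inner, heq])
      rw [hF_outer x heq.ge, ← hsphere, h]
      exact congrArg H (Prod.ext rfl (by norm_num [heq]))
  have hF : Continuous F := by
    have hnorm : Continuous fun x : closedBall (0 : E) 1 => ‖(x : E)‖ := by fun_prop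
    refine continuous_of_restrict_le continuous_const hnorm
      ((H.continuous.comp ?_).congr fun x => (hF_outer x.1 x.2).symm)
      ((G.continuous.comp ?_).congr fun x => (hF_inner x.1 x.2).symm)
    · exact (continuous_radial (by fun_prop) _).prodMk (by fun_prop)
    · exact Continuous.subtype_mk (by fun_prop) _
  exact ⟨⟨F, hF⟩, hF_outer, fun x hx => ⟨_, hF_inner x hx⟩⟩

theorem scaleBall_norm_radial (x : closedBall (0 : E) 1) (hx : (x : E) ≠ 0) :
    scaleBall ⟨‖(x : E)‖, norm_nonneg _, norm_le_one x⟩ (sphereToBall E (radial x.1 hx)) = x :=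
  Subtype.ext (smul_inv_smul₀ (norm_ne_zero_iff.2 hx) _)

theorem exists_radial_nullhomotopy (k : C(closedBall (0 : E) 1, W)) {b : W}
    (hb : Joined (k ⟨0, mem_closedBall_self zero_le_one⟩) b) :
    ∃ D : C(closedBall (0 : E) 1 × ℝ, W), (∀ x, D (x, 0) = k x) ∧ ∀ x s, 2 ≤ s → D (x, s) = b := by
  obtain ⟨γ⟩ := hb
  refine ⟨⟨fun q => if q.2 ≤ 1 then k (scaleBall (Set.projIcc 0 1 zero_le_one (1 - q.2)) q.1)
    else γ.extend (q.2 - 1), Continuous.if_le (by fun_prop) (by fun_prop) (by fun_prop)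
      (by fun_prop) fun q hq => ?_⟩, fun x => ?_, fun x s hs => ?_⟩
  · simp [hq, scaleBall_zero]
  · simp [scaleBall_one]
  · have h1 : ¬s ≤ 1 := by linarith
    simp only [ContinuousMap.coe_mk, if_neg h1]
    exact γ.extend_of_one_le (by linarith)

end Scale

namespace PtdSpace

section Lifting

variable [NormedSpace ℝ E] {A : PtdSpace.{u}} {B : PtdSpace.{v}} {f : Map A B}

theorem exists_lift_of_eq_pt (hf : HasBallExtension E (hfib f)) {κ : C(closedBall (0 : E) 1, B)}
    (hκ : ∀ x : closedBall (0 : E) 1, ‖(x : E)‖ ≤ 1 / 2 → κ x = B.pt)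
    (g : C(sphere (0 : E) 1, MappingPath f.1)) (hg : ∀ θ, (g θ).last = κ (sphereToBall E θ)) :
    ∃ G : C(closedBall (0 : E) 1, MappingPath f.1), (∀ θ, G (sphereToBall E θ) = g θ) ∧
      ∀ x, (G x).last = κ x := by
  obtain ⟨H, hH, hlast⟩ := MappingPath.exists_lift_homotopy g
    ⟨fun p => κ (scaleBall (Set.projIcc 0 1 zero_le_one (1 - p.2)) (sphereToBall E p.1)), by
      fun_prop⟩ fun θ => by simp [hg, scaleBall_one]
  have hhalf θ : (H (θ, 1 / 2)).last = B.pt := by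
    rw [hlast _ _ (by norm_num)]
    refine hκ _ ?_
    rw [Set.projIcc_of_mem zero_le_one (show (1 - 1 / 2 : ℝ) ∈ I by norm_num)]
    norm_num [scaleBall, norm_smul, norm_sphereToBall]
  obtain ⟨G', hG'⟩ := hf ⟨fun θ => ⟨H (θ, 1 / 2), hhalf θ⟩,
    Continuous.subtype_mk (by fun_prop) hhalf⟩
  obtain ⟨F, hF_outer, hF_inner⟩ := exists_glue_shell H
    ⟨fun x => (G' x).1, continuous_subtype_val.comp G'.continuous⟩
    fun θ => congrArg Subtype.val (hG' θ)
  refine ⟨F, fun θ => ?_, fun x => ?_⟩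
  · have hθ : 1 / 2 ≤ ‖(sphereToBall E θ : E)‖ := by norm_num [norm_sphereToBall]
    rw [hF_outer _ hθ, ← hH]
    exact congrArg H (Prod.ext (radial_sphereToBall θ (ne_zero_of_half_le hθ))
      (by simp [norm_sphereToBall]))
  · rcases le_total (1 / 2) ‖(x : E)‖ with hx | hx
    · rw [hF_outer x hx, hlast _ _ (sub_nonneg.2 (norm_le_one x))]
      simp only [ContinuousMap.coe_mk, sub_sub_cancel]
      rw [Set.projIcc_of_mem zero_le_one ⟨norm_nonneg _, norm_le_one x⟩, scaleBall_norm_radial]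
    · obtain ⟨y, hy⟩ := hF_inner x hx
      rw [hy, hκ x hx]
      exact (G' y).2

theorem hasBallLifting_last (hf : HasBallExtension E (hfib f)) (hB : ∀ b : B, Joined b B.pt) :
    HasBallLifting E (MappingPath.last : MappingPath f.1 → B) := by
  intro k g hg
  obtain ⟨D, hD, hD_pt⟩ := exists_radial_nullhomotopy k (hB _)
  obtain ⟨G, hGg, hG⟩ := exists_lift_of_eq_pt hf
    (κ := ⟨fun x => D (x, 4 * (1 - ‖(x : E)‖)), by fun_prop⟩)
    (fun x hx => hD_pt _ _ (by linarith)) g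
    (fun θ => by simp [norm_sphereToBall, hD, hg])
  obtain ⟨H, hH, hlast⟩ := MappingPath.exists_lift_homotopy G
    ⟨fun p => D (p.1, 4 * (1 - ‖(p.1 : E)‖) - p.2), by fun_prop⟩ fun x => by simp [hG]
  refine ⟨⟨fun x => H (x, 4 * (1 - ‖(x : E)‖)), by fun_prop⟩, fun θ => ?_, fun x => ?_⟩
  · simp [norm_sphereToBall, hH, hGg]
  · rw [ContinuousMap.coe_mk, hlast x _ (by linarith [norm_le_one x])]
    simp [hD]

end Lifting

variable {W : PtdSpace.{u}}

variable (W) in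
/-- The diagonal map from a pointed space to its square. -/
def diagonal : Map W (pi fun _ : Bool => W) := ⟨⟨fun w _ => w, by fun_prop⟩, rfl⟩

/-- The height of the bottom and top faces of the cylinder `closedBall 0 1 ×ˢ Icc (-1) 1`. -/
def faceHeight (b : Bool) : ℝ := bif b then 1 else -1

theorem abs_faceHeight (b : Bool) : |faceHeight b| = 1 := by cases b <;> simp [faceHeight]

theorem faceHeight_decide_mul_abs (t : ℝ) : faceHeight (decide (0 ≤ t)) * |t| = t := by
  rcases le_or_gt 0 t with ht | ht
  · simp [faceHeight, ht, abs_of_nonneg]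
  · simp [faceHeight, ht.not_ge, abs_of_neg ht]

/-- A map on the boundary of the cylinder is a map on the sphere into the mapping path space of the
diagonal (the lateral boundary, parametrized from its equator) which lifts a map from the ball to
the square (the bottom and top faces). -/
theorem exists_cylinder_boundary (g : C(sphere (0 : E × ℝ) 1, W)) :
    ∃ (z : C(sphere (0 : E) 1, MappingPath (diagonal W).1))
      (k : C(closedBall (0 : E) 1, pi fun _ : Bool => W)),
      (∀ θ, (z θ).last = k (sphereToBall E θ)) ∧
      (∀ (θ : sphere (0 : E) 1) (y : sphere (0 : E × ℝ) 1) (s : I) b,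
        y.1 = (θ.1, faceHeight b * s) → (z θ).path s b = g y) ∧
      ∀ (x : closedBall (0 : E) 1) (y : sphere (0 : E × ℝ) 1) b,
        y.1 = (x.1, faceHeight b) → k x b = g y := by
  have hside (θ : sphere (0 : E) 1) (s : I) b :
      ((θ : E), faceHeight b * (s : ℝ)) ∈ sphere (0 : E × ℝ) 1 := by
    simp [Prod.norm_def, abs_faceHeight, abs_of_nonneg s.2.1, s.2.2]
  have hface (x : closedBall (0 : E) 1) b : ((x : E), faceHeight b) ∈ sphere (0 : E × ℝ) 1 := by
    simp [Prod.norm_def, abs_faceHeight, norm_le_one x]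
  let γ (θ : sphere (0 : E) 1) : C(I, pi fun _ : Bool => W) :=
    ⟨fun s b => g ⟨_, hside θ s b⟩, by fun_prop⟩
  have hγ0 θ : γ θ 0 = (diagonal W).1 (g ⟨_, hside θ 0 true⟩) :=
    funext fun b => congrArg g (Subtype.ext (by simp))
  refine ⟨⟨fun θ => ⟨(_, γ θ), hγ0 θ⟩, MappingPath.continuous_mk hγ0 (by fun_prop) ?_⟩,
    ⟨fun x b => g ⟨_, hface x b⟩, by fun_prop⟩, fun θ => ?_, fun θ y s b hy => ?_,
    fun x y b hy => ?_⟩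
  · change Continuous fun (p : sphere (0 : E) 1 × I) b => g ⟨_, hside p.1 p.2 b⟩
    fun_prop
  · exact funext fun b => congrArg g (Subtype.ext (by simp [sphereToBall]))
  · exact congrArg g (Subtype.ext hy.symm)
  · exact congrArg g (Subtype.ext hy.symm)

theorem hasBallExtension_prod_of_hasBallLifting
    (h : HasBallLifting E (MappingPath.last : MappingPath (diagonal W).1 → pi fun _ : Bool => W)) :
    HasBallExtension (E × ℝ) W := by
  intro g
  obtain ⟨z, k, hzk, hz, hk⟩ := exists_cylinder_boundary g
  obtain ⟨G, hGz, hGk⟩ := h k z hzk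
  let p (y : closedBall (0 : E × ℝ) 1) : closedBall (0 : E) 1 :=
    ⟨y.1.1, mem_closedBall_zero_iff.2 ((norm_fst_le _).trans (norm_le_one y))⟩
  let F (b : Bool) (y : closedBall (0 : E × ℝ) 1) : W :=
    (G (p y)).path (Set.projIcc 0 1 zero_le_one |y.1.2|) b
  have hp : Continuous p := by fun_prop
  have hF b : Continuous (F b) := (continuous_apply b).comp <|
    (MappingPath.continuous_path.comp (G.continuous.comp hp)).eval (by fun_prop)
  have hF0 b y (hy : y.1.2 = 0) : F b y = (G (p y)).fst := by
    simp only [F, hy, abs_zero, Set.projIcc_left]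
    exact congrFun (G (p y)).path_zero b
  have hFg (y : sphere (0 : E × ℝ) 1) b (hy : faceHeight b * |y.1.2| = y.1.2) :
      F b (sphereToBall _ y) = g y := by
    have hmax : max ‖y.1.1‖ |y.1.2| = 1 := norm_eq_of_mem_sphere y
    rcases max_eq_iff.1 hmax with ⟨h1, h2⟩ | ⟨h1, -⟩
    · have hθ : p (sphereToBall _ y) = sphereToBall E ⟨y.1.1, mem_sphere_zero_iff_norm.2 h1⟩ := rfl
      simp only [F, hθ, hGz]
      refine hz _ y _ b (Prod.ext rfl ?_)
      change y.1.2 = faceHeight b * (Set.projIcc 0 1 zero_le_one |y.1.2| : ℝ)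
      rw [Set.projIcc_of_mem zero_le_one ⟨abs_nonneg _, h2.trans h1.le⟩]
      exact hy.symm
    · have hs : Set.projIcc (0 : ℝ) 1 zero_le_one |y.1.2| = 1 := by
        rw [h1, Set.projIcc_right]
        rfl
      refine (congrArg (fun s => (G (p (sphereToBall _ y))).path s b) hs).trans ?_
      exact (congrFun (hGk _) b).trans (hk _ y b (Prod.ext rfl (by rw [← hy, h1, mul_one])))
  refine ⟨⟨fun y => if 0 ≤ y.1.2 then F true y else F false y, Continuous.if_le (hF true) (hF false)
    (by fun_prop) (by fun_prop) fun y hy => ?_⟩, fun y => ?_⟩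
  · rw [hF0 _ y hy.symm, hF0 _ y hy.symm]
  · rw [← hFg y _ (faceHeight_decide_mul_abs _)]
    by_cases hy : 0 ≤ y.1.2
    · simp [hy, sphereToBall]
    · simp [hy, sphereToBall]

end PtdSpace

theorem HasBallExtension.of_isometryEquiv {F W : Type*} [NormedAddCommGroup F] [TopologicalSpace W]
    (h : HasBallExtension E W) (e : E ≃ᵢ F) (he : e 0 = 0) : HasBallExtension F W := by
  have hnorm (x : E) : ‖e x‖ = ‖x‖ := by
    rw [← dist_zero_right, ← he, e.dist_eq, dist_zero_right]
  have hnorm_symm (y : F) : ‖e.symm y‖ = ‖y‖ := by rw [← hnorm, e.apply_symm_apply]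
  intro g
  obtain ⟨G, hG⟩ := h (g.comp ⟨fun θ => ⟨e θ.1, by simp [hnorm]⟩, by fun_prop⟩)
  refine ⟨G.comp ⟨fun y => ⟨e.symm y.1, by simpa [hnorm_symm] using norm_le_one y⟩, by fun_prop⟩,
    fun θ => ?_⟩
  refine (hG ⟨e.symm θ.1, by simp [hnorm_symm]⟩).trans ?_
  exact congrArg g (Subtype.ext (e.apply_symm_apply θ.1))

namespace PtdSpace

theorem IsWeaklyContractible.joined {W : PtdSpace.{u}} (hW : W.IsWeaklyContractible) (w : W) :
    Joined w W.pt := hW 0 w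

theorem IsWeaklyContractible.hasBallExtension (n : ℕ) :
    ∀ {W : PtdSpace.{u}}, W.IsWeaklyContractible → HasBallExtension (Fin n → ℝ) W := by
  induction n with
  | zero =>
    intro W _ g
    have : IsEmpty (sphere (0 : Fin 0 → ℝ) 1) := sphere_isEmpty_of_subsingleton
    exact ⟨.const _ W.pt, isEmptyElim⟩
  | succ n ih =>
    intro W hW
    have hW2 : (PtdSpace.pi fun _ : Bool => W).IsWeaklyContractible := .pi fun _ => hW
    have hlift : HasBallLifting (Fin n → ℝ)
        (MappingPath.last : MappingPath (diagonal W).1 → PtdSpace.pi fun _ : Bool => W) :=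
      hasBallLifting_last (ih (hW.isWeakEquiv hW2 _).hfib) hW2.joined
    let unique := (IsometryEquiv.funUnique (Fin 1) ℝ).symm
    let split : (Fin n → ℝ) × ℝ ≃ᵢ (Fin n → ℝ) × (Fin 1 → ℝ) :=
      ⟨(Equiv.refl _).prodCongr unique.toEquiv, isometry_id.prodMap unique.isometry⟩
    refine (hasBallExtension_prod_of_hasBallLifting hlift).of_isometryEquiv
      (split.trans (Fin.appendIsometry n 1)) ?_
    have hsplit : split 0 = 0 := rfl
    exact funext fun i => Fin.addCases (fun j => by simp [hsplit]) (fun j => by simp [hsplit]) i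

theorem Map.IsWeakEquiv.hasBallLifting_last {A : PtdSpace.{u}} {B : PtdSpace.{v}} {f : Map A B}
    (hf : f.IsWeakEquiv) (hB : ∀ b : B, Joined b B.pt) (n : ℕ) :
    HasBallLifting (Fin n → ℝ) (MappingPath.last : MappingPath f.1 → B) :=
  PtdSpace.hasBallLifting_last (hf.hfib.hasBallExtension n) hB

end PtdSpace

end

end BallExtension

/-! ### Lifting along cell complexes -/

section CellularLifting

open Topology Topology.RelCWComplex Metric

variable {K : Type u} [TopologicalSpace K] [CWComplex (Set.univ : Set K)]

theorem exists_mem_openCell_univ (x : K) :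
    ∃ (n : ℕ) (i : cell (Set.univ : Set K) n), x ∈ openCell n i := by
  simpa using (CWComplex.iUnion_openCell_eq_complex (C := (Set.univ : Set K))).ge (Set.mem_univ x)

/-- The dimension of the open cell containing a given point of a CW complex. -/
noncomputable def cellDim (x : K) : ℕ := (exists_mem_openCell_univ x).choose

theorem exists_mem_openCell_cellDim (x : K) :
    ∃ i : cell (Set.univ : Set K) (cellDim x), x ∈ openCell (cellDim x) i :=
  (exists_mem_openCell_univ x).choose_spec

theorem eq_of_mem_openCell {x : K} {n m : ℕ} {i : cell (Set.univ : Set K) n}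
    {j : cell (Set.univ : Set K) m} (hi : x ∈ openCell n i) (hj : x ∈ openCell m j) :
    (⟨n, i⟩ : Σ n, cell (Set.univ : Set K) n) = ⟨m, j⟩ :=
  eq_of_not_disjoint_openCell (Set.not_disjoint_iff.2 ⟨x, hi, hj⟩)

theorem cellDim_eq_of_mem_openCell {x : K} {n : ℕ} {i : cell (Set.univ : Set K) n}
    (hx : x ∈ openCell n i) : cellDim x = n :=
  congrArg Sigma.fst (eq_of_mem_openCell (exists_mem_openCell_cellDim x).choose_spec hx)

theorem cellDim_lt_of_mem_cellFrontier {x : K} {n : ℕ} {i : cell (Set.univ : Set K) n}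
    (hx : x ∈ cellFrontier n i) : cellDim x < n := by
  obtain ⟨J, hJ⟩ := CWComplex.cellFrontier_subset_finite_openCell n i
  obtain ⟨m, hm, j, -, hj⟩ : ∃ m < n, ∃ j, j ∈ J m ∧ x ∈ openCell m j := by simpa using hJ hx
  rwa [cellDim_eq_of_mem_openCell hj]

theorem cellDim_le_of_mem_closedCell {x : K} {n : ℕ} {i : cell (Set.univ : Set K) n}
    (hx : x ∈ closedCell n i) : cellDim x ≤ n := by
  rw [← cellFrontier_union_openCell_eq_closedCell] at hx
  exact hx.elim (fun h => (cellDim_lt_of_mem_cellFrontier h).le)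
    fun h => (cellDim_eq_of_mem_openCell h).le

/-- The characteristic map of a cell, as a continuous map on the closed unit ball. -/
def charMap {n : ℕ} (i : cell (Set.univ : Set K) n) : C(closedBall (0 : Fin n → ℝ) 1, K) :=
  ⟨fun x => map n i x, continuousOn_iff_continuous_domRestrict.1 (continuousOn n i)⟩

theorem range_charMap {n : ℕ} (i : cell (Set.univ : Set K) n) :
    Set.range (charMap i) = closedCell n i := by
  rw [closedCell, Set.image_eq_range]
  rfl

theorem charMap_sphereToBall_mem {n : ℕ} (i : cell (Set.univ : Set K) n)
    (θ : sphere (0 : Fin n → ℝ) 1) : charMap i (sphereToBall _ θ) ∈ cellFrontier n i :=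
  ⟨θ, θ.2, rfl⟩

theorem joined_of_mem_closedCell {n : ℕ} {i : cell (Set.univ : Set K) n} {x y : K}
    (hx : x ∈ closedCell n i) (hy : y ∈ closedCell n i) : Joined x y := by
  have : IsPathConnected (closedCell n i) :=
    ((convex_closedBall (0 : Fin n → ℝ) 1).isPathConnected ⟨0, by simp⟩).image' (continuousOn n i)
  exact (this.joinedIn x hx y hy).joined

theorem exists_modify_openCell {T : Type v} {n : ℕ} (g : K → T)
    (G : cell (Set.univ : Set K) n → closedBall (0 : Fin n → ℝ) 1 → T)
    (hG : ∀ i θ, G i (sphereToBall _ θ) = g (charMap i (sphereToBall _ θ))) :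
    ∃ g' : K → T, (∀ i x, g' (charMap i x) = G i x) ∧ ∀ x, cellDim x ≠ n → g' x = g x := by
  let q (p : cell (Set.univ : Set K) n × ball (0 : Fin n → ℝ) 1) : K := map n p.1 p.2
  have hq p : q p ∈ openCell n p.1 := ⟨p.2, p.2.2, rfl⟩
  have hq_inj : Function.Injective q := by
    rintro ⟨i, x⟩ ⟨j, y⟩ hxy
    obtain rfl : i = j := eq_of_heq
      (Sigma.mk.inj_iff.1 (eq_of_mem_openCell (hq (i, x)) (hxy ▸ hq (j, y)))).2
    exact Prod.ext rfl (Subtype.ext ((map n i).injOn ((source_eq n i).ge x.2)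
      ((source_eq n i).ge y.2) hxy))
  let g' := Function.extend q (fun p => G p.1 ⟨p.2, ball_subset_closedBall p.2.2⟩) g
  have hg' x (hx : cellDim x ≠ n) : g' x = g x := by
    refine Function.extend_apply' _ _ _ ?_
    rintro ⟨p, rfl⟩
    exact hx (cellDim_eq_of_mem_openCell (hq p))
  refine ⟨g', fun i x => ?_, hg'⟩
  rcases (norm_le_one x).lt_or_eq with hx | hx
  · exact hq_inj.extend_apply _ _ (i, ⟨x, mem_ball_zero_iff.2 hx⟩)
  · obtain ⟨θ, rfl⟩ : ∃ θ, sphereToBall _ θ = x := ⟨⟨x, mem_sphere_zero_iff_norm.2 hx⟩, rfl⟩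
    rw [hG, hg' _ (cellDim_lt_of_mem_cellFrontier (charMap_sphereToBall_mem i θ)).ne]

variable {T : Type v} [TopologicalSpace T]

/-- Continuity of `g` on each closed cell of dimension at most `n`. -/
def ContinuousOnCells (n : ℕ) (g : K → T) : Prop :=
  ∀ m ≤ n, ∀ i : cell (Set.univ : Set K) m, ContinuousOn g (closedCell m i)

theorem continuousOnCells_zero (g : K → T) : ContinuousOnCells 0 g := by
  rintro m hm i
  obtain rfl : m = 0 := Nat.le_zero.1 hm
  rw [closedCell_zero_eq_singleton]
  exact continuousOn_singleton _ _

variable [T2Space K]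

theorem ContinuousOnCells.continuousOn_cellFrontier {n : ℕ} {g : K → T}
    (h : ContinuousOnCells n g) (i : cell (Set.univ : Set K) (n + 1)) :
    ContinuousOn g (cellFrontier (n + 1) i) := by
  obtain ⟨J, hJ⟩ := CWComplex.cellFrontier_subset_finite_closedCell (n + 1) i
  have hunion : ContinuousOn g (⋃ q : Σ m : Fin (n + 1), J m, closedCell q.1.1 q.2.1) :=
    (locallyFinite_of_finite _).continuousOn_iUnion (fun q => isClosed_closedCell)
      fun q => h q.1 (Nat.lt_succ_iff.1 q.1.2) q.2
  refine hunion.mono (hJ.trans fun x hx => ?_)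
  simp only [Set.mem_iUnion, exists_prop] at hx ⊢
  obtain ⟨m, hm, j, hj, hx⟩ := hx
  exact ⟨⟨⟨m, hm⟩, ⟨j, hj⟩⟩, hx⟩

theorem continuousOn_closedCell_iff {n : ℕ} {i : cell (Set.univ : Set K) n} {g : K → T} :
    ContinuousOn g (closedCell n i) ↔ Continuous (g ∘ charMap i) := by
  have hquot : IsQuotientMap (Set.rangeFactorization (charMap i)) :=
    .of_surjective_continuous Set.rangeFactorization_surjective
      (charMap i).continuous.rangeFactorization
  rw [← range_charMap, continuousOn_iff_continuous_domRestrict, hquot.continuous_iff]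
  rfl

theorem continuous_cellDim_of_continuousOnCells {s : ℕ → K → T}
    (hs : ∀ n, ContinuousOnCells n (s n)) (hstable : ∀ n x, cellDim x ≤ n → s (n + 1) x = s n x) :
    Continuous fun x => s (cellDim x) x := by
  have hstable' (n x) (hx : cellDim x ≤ n) : s n x = s (cellDim x) x := by
    induction n, hx using Nat.le_induction with
    | base => rfl
    | succ n hn ih => rw [hstable n x hn, ih]
  refine continuous_iff_isClosed.2 fun C hC =>
    (CWComplex.closed (Set.univ : Set K) _ (Set.subset_univ _)).2 fun n i => ?_
  rw [Set.inter_comm]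
  refine ContinuousOn.preimage_isClosed_of_isClosed ((hs n n le_rfl i).congr fun x hx => ?_)
    isClosed_closedCell hC
  exact (hstable' n x (cellDim_le_of_mem_closedCell hx)).symm

variable {B : Type w} [TopologicalSpace B] {p : T → B} {h : K → B}

/-- The lifting property of a map with respect to the boundary inclusions of balls of all
dimensions. -/
def HasCellLifting (p : T → B) : Prop := ∀ n : ℕ, HasBallLifting (Fin n → ℝ) p

theorem HasCellLifting.surjective (hp : HasCellLifting p) : Function.Surjective p := by
  intro b
  have : IsEmpty (sphere (0 : Fin 0 → ℝ) 1) := sphere_isEmpty_of_subsingleton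
  obtain ⟨G, -, hG⟩ := hp 0 (.const _ b) ⟨isEmptyElim, continuous_of_const isEmptyElim⟩ isEmptyElim
  exact ⟨G ⟨0, mem_closedBall_self zero_le_one⟩, hG _⟩

theorem HasCellLifting.exists_extend (hp : HasCellLifting p) (hh : Continuous h) {n : ℕ}
    {g : K → T} (hgp : ∀ x, p (g x) = h x) (hg : ContinuousOnCells n g) :
    ∃ g' : K → T, (∀ x, p (g' x) = h x) ∧ ContinuousOnCells (n + 1) g' ∧
      ∀ x, cellDim x ≤ n → g' x = g x := by
  have hlift (i : cell (Set.univ : Set K) (n + 1)) :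
      ∃ G : C(closedBall (0 : Fin (n + 1) → ℝ) 1, T),
        (∀ θ, G (sphereToBall _ θ) = g (charMap i (sphereToBall _ θ))) ∧
          ∀ x, p (G x) = h (charMap i x) :=
    hp (n + 1) ⟨fun x => h (charMap i x), by fun_prop⟩
      ⟨fun θ => g (charMap i (sphereToBall _ θ)), (hg.continuousOn_cellFrontier i).comp_continuous
        (by fun_prop) (charMap_sphereToBall_mem i)⟩ fun _ => hgp _
  choose G hG hGp using hlift
  obtain ⟨g', hg'G, hg'⟩ := exists_modify_openCell g (fun i => G i) hG
  have hg'_low x (hx : cellDim x ≤ n) : g' x = g x := hg' x (Nat.lt_succ_of_le hx).ne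
  refine ⟨g', fun x => ?_, fun m hm i => ?_, hg'_low⟩
  · by_cases hx : cellDim x = n + 1
    · obtain ⟨i, hi⟩ := hx ▸ exists_mem_openCell_cellDim x
      obtain ⟨y, rfl⟩ : x ∈ Set.range (charMap i) :=
        range_charMap i ▸ openCell_subset_closedCell _ _ hi
      rw [hg'G, hGp]
    · rw [hg' x hx, hgp]
  · rcases Nat.le_succ_iff.1 hm with hm | rfl
    · exact (hg m hm i).congr fun x hx => hg'_low x ((cellDim_le_of_mem_closedCell hx).trans hm)
    · exact continuousOn_closedCell_iff.2 ((G i).continuous.congr fun x => (hg'G i x).symm)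

theorem HasCellLifting.exists_seq_lift (hp : HasCellLifting p) (hh : Continuous h) {g₀ : K → T}
    (hg₀ : ∀ x, p (g₀ x) = h x) :
    ∃ s : ℕ → K → T, s 0 = g₀ ∧ (∀ n x, p (s n x) = h x) ∧ (∀ n, ContinuousOnCells n (s n)) ∧
      ∀ n x, cellDim x ≤ n → s (n + 1) x = s n x := by
  have hstep n (g : {g : K → T // (∀ x, p (g x) = h x) ∧ ContinuousOnCells n g}) :
      ∃ g' : {g : K → T // (∀ x, p (g x) = h x) ∧ ContinuousOnCells (n + 1) g},
        ∀ x, cellDim x ≤ n → g'.1 x = g.1 x := by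
    obtain ⟨g', hg'p, hg', hg'_low⟩ := hp.exists_extend hh g.2.1 g.2.2
    exact ⟨⟨g', hg'p, hg'⟩, hg'_low⟩
  choose next hnext using hstep
  let s (n : ℕ) : {g : K → T // (∀ x, p (g x) = h x) ∧ ContinuousOnCells n g} :=
    Nat.rec ⟨g₀, hg₀, continuousOnCells_zero g₀⟩ next n
  exact ⟨fun n => (s n).1, rfl, fun n => (s n).2.1, fun n => (s n).2.2, fun n => hnext n (s n)⟩

theorem HasCellLifting.exists_lift (hp : HasCellLifting p) (hh : Continuous h) {x₀ : K}
    (hx₀ : cellDim x₀ = 0) {e₀ : T} (he₀ : p e₀ = h x₀) :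
    ∃ g : K → T, Continuous g ∧ g x₀ = e₀ ∧ ∀ x, p (g x) = h x := by
  classical
  let g₀ := Function.update (fun x => Function.surjInv hp.surjective (h x)) x₀ e₀
  have hg₀ x : p (g₀ x) = h x := by
    rcases eq_or_ne x x₀ with rfl | hx
    · simp only [g₀, Function.update_self, he₀]
    · simp only [g₀, Function.update_of_ne hx, Function.surjInv_eq]
  obtain ⟨s, hs0, hsp, hs, hstable⟩ := hp.exists_seq_lift hh hg₀
  refine ⟨_, continuous_cellDim_of_continuousOnCells hs hstable, ?_, fun x => hsp _ x⟩
  rw [hx₀, hs0]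
  exact Function.update_self ..

theorem isClosed_of_joined_mem {S : Set K} (hS : ∀ x ∈ S, ∀ y, Joined x y → y ∈ S) :
    IsClosed S := by
  refine (CWComplex.closed (Set.univ : Set K) S (Set.subset_univ _)).2 fun n i => ?_
  rcases (S ∩ closedCell n i).eq_empty_or_nonempty with h | ⟨x, hxS, hx⟩
  · rw [h]
    exact isClosed_empty
  · rw [Set.inter_eq_right.2 fun y hy => hS x hxS y (joined_of_mem_closedCell hx hy)]
    exact isClosed_closedCell

variable (K) in
theorem pathConnectedSpace_of_cwComplex [ConnectedSpace K] : PathConnectedSpace K := by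
  obtain ⟨x₀⟩ := (inferInstance : Nonempty K)
  have hclopen : IsClopen {x : K | Joined x₀ x} :=
    ⟨isClosed_of_joined_mem fun x hx y hxy => hx.trans hxy,
      isClosed_compl_iff.1 <| isClosed_of_joined_mem fun x hx y hxy hy => hx (hy.trans hxy.symm)⟩
  have hjoined (x : K) : Joined x₀ x := (hclopen.eq_univ ⟨x₀, Joined.refl x₀⟩).ge (Set.mem_univ x)
  exact ⟨⟨x₀⟩, fun x y => (hjoined x).symm.trans (hjoined y)⟩

end CellularLifting

namespace PtdSpace

/-! ### Whitehead's theorem -/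

section Whitehead

variable {A : PtdSpace.{u}} {B : PtdSpace.{v}} {X : PtdSpace.{w}}

theorem HEquiv.pathConnectedSpace (h : HEquiv A B) [PathConnectedSpace B] :
    PathConnectedSpace A := by
  obtain ⟨f, g, hgf, -⟩ := h
  obtain ⟨F, hF, h0, h1, -⟩ := Map.homotopic_iff.1 hgf
  have hjoined (x : A) : Joined A.pt x := by
    have hhomotopy : Joined (g.1 (f.1 x)) x :=
      ⟨⟨⟨fun s => F (s, x), by fun_prop⟩, h0 x, h1 x⟩⟩
    have hpath : Joined (g.1 B.pt) (g.1 (f.1 x)) :=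
      (PathConnectedSpace.joined B.pt (f.1 x)).map g.1.continuous
    rw [g.2] at hpath
    exact hpath.trans hhomotopy
  exact ⟨⟨A.pt⟩, fun x y => (hjoined x).symm.trans (hjoined y)⟩

theorem HasConnectedCWType.pathConnectedSpace (h : HasConnectedCWType X) :
    PathConnectedSpace X := by
  obtain ⟨K, _, _, _, -, hK⟩ := h
  have := pathConnectedSpace_of_cwComplex K
  exact hK.pathConnectedSpace

theorem HasConnectedCWType.exists_lift (hX : HasConnectedCWType X) [PathConnectedSpace A]
    [PathConnectedSpace B] (f : Map A B) (hf : Function.Bijective f.totalPi) (h : Map X B) :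
    ∃ g : Map X A, (f.comp g).Homotopic h := by
  obtain ⟨K, _, _, _, ⟨i, hi⟩, a, b, hba, -⟩ := hX
  have hlift : HasCellLifting (MappingPath.last : MappingPath f.1 → B) :=
    (Map.isWeakEquiv_of_bijective_totalPi hf).hasBallLifting_last
      fun _ => PathConnectedSpace.joined _ _
  obtain ⟨G, hG, hG0, hGp⟩ := hlift.exists_lift (h.comp b).1.continuous
    (cellDim_eq_of_mem_openCell hi) (e₀ := ⟨(A.pt, .const _ B.pt), f.2.symm⟩) (h.comp b).2.symm
  let g : Map K A := ⟨⟨fun x => (G x).fst, by fun_prop⟩, congrArg MappingPath.fst hG0⟩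
  have hg : (f.comp g).Homotopic (h.comp b) :=
    Map.homotopic_iff.2 ⟨fun p => (G p.2).path p.1,
      (MappingPath.continuous_path.comp (hG.comp continuous_snd)).eval continuous_fst,
      fun x => (G x).path_zero, hGp, fun s => congrArg (fun z => z.path s) hG0⟩
  exact ⟨g.comp a, (hg.comp (Map.Homotopic.refl a)).trans ((Map.Homotopic.refl h).comp hba)⟩

theorem Map.exists_inverse (hA : A.HasConnectedCWType) (hB : B.HasConnectedCWType) (f : Map A B)
    (hf : Function.Bijective f.totalPi) :
    ∃ g : Map B A, (g.comp f).Homotopic (Map.id A) ∧ (f.comp g).Homotopic (Map.id B) := by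
  have := hA.pathConnectedSpace
  have := hB.pathConnectedSpace
  obtain ⟨g, hg⟩ := hB.exists_lift f hf (Map.id B)
  have hfg : Function.LeftInverse f.totalPi g.totalPi := fun x => by
    simpa [totalPi_comp, totalPi_id] using DFunLike.congr_fun hg.totalPi x
  have hg_bij : Function.Bijective g.totalPi :=
    ⟨hfg.injective, fun a => ⟨f.totalPi a, hf.1 (hfg _)⟩⟩
  obtain ⟨k, hk⟩ := hA.exists_lift g hg_bij (Map.id A)
  have hfk : f.Homotopic k :=
    ((Map.Homotopic.refl f).comp hk).symm.trans (hg.comp (Map.Homotopic.refl k))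
  exact ⟨g, ((Map.Homotopic.refl g).comp hfk).trans hk, hg⟩

end Whitehead

noncomputable section

/-! ### Products -/

section Pi

variable {X : PtdSpace.{u}} {ι : Type t} {F : ι → PtdSpace.{v}}

/-- The projections from a product. -/
def proj (F : ι → PtdSpace.{v}) (i : ι) : Map (pi F) (F i) :=
  ⟨⟨fun x : ∀ i, F i => x i, continuous_apply i⟩, rfl⟩

/-- The map to a product with given components. -/
def Map.toPi (f : ∀ i, Map X (F i)) : Map X (pi F) :=
  ⟨⟨fun x => (fun i => (f i).1 x : ∀ i, F i), continuous_pi fun i => (f i).1.continuous⟩,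
    funext fun i => (f i).2⟩

theorem proj_comp_toPi (f : ∀ i, Map X (F i)) (i : ι) : (proj F i).comp (Map.toPi f) = f i := rfl

theorem Map.homotopic_pi {f g : Map X (pi F)}
    (h : ∀ i, ((proj F i).comp f).Homotopic ((proj F i).comp g)) : f.Homotopic g := by
  choose G hG h0 h1 hpt using fun i => Map.homotopic_iff.1 (h i)
  exact Map.homotopic_iff.2 ⟨fun p => (fun i => G i p : ∀ i, F i), continuous_pi hG,
    fun x => funext fun i => h0 i x, fun x => funext fun i => h1 i x,
    fun s => funext fun i => hpt i s⟩

/-- The product of H-structures. -/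
def HStructure.pi (H : ∀ i, HStructure (F i)) : HStructure (PtdSpace.pi F) :=
  HStructure.ofHomotopic (X := PtdSpace.pi F)
    ⟨fun p => (fun i => (H i).toHSpace.hmul ((proj F i).1 p.1, (proj F i).1 p.2) : ∀ i, F i),
      continuous_pi fun i => by fun_prop⟩
    (funext fun i => (H i).hmul_pt)
    (Map.homotopic_pi fun i => (H i).zero_add_homotopic (proj F i))
    (Map.homotopic_pi fun i => (H i).add_zero_homotopic (proj F i))

theorem proj_comp_add (H : ∀ i, HStructure (F i)) (f g : Map X (pi F)) (i : ι) :
    (proj F i).comp (Map.add (HStructure.pi H) f g) =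
      Map.add (H i) ((proj F i).comp f) ((proj F i).comp g) := rfl

instance [h : ∀ i, IsH (F i)] : IsH (pi F) :=
  ⟨⟨HStructure.pi fun i => (h i).nonempty.some⟩⟩

variable [DecidableEq ι]

/-- The self-map of a product keeping the coordinates in `s` and replacing the others by the base
point. -/
def coords (F : ι → PtdSpace.{v}) (s : Finset ι) : Map (pi F) (pi F) :=
  Map.toPi fun i => if i ∈ s then proj F i else Map.zero _ _

/-- The inclusions into a product. -/
def incl (F : ι → PtdSpace.{v}) (i : ι) : Map (F i) (pi F) :=
  Map.toPi fun j => if h : i = j then h ▸ Map.id (F i) else Map.zero _ _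

theorem proj_comp_incl_self (i : ι) : (proj F i).comp (incl F i) = Map.id (F i) := by
  rw [incl, proj_comp_toPi, dif_pos rfl]

theorem proj_comp_incl_of_ne {i j : ι} (h : i ≠ j) :
    (proj F j).comp (incl F i) = Map.zero (F i) (F j) := by
  rw [incl, proj_comp_toPi, dif_neg h]

theorem coords_empty : coords F ∅ = Map.zero _ _ := by
  simp only [coords, Finset.notMem_empty, if_false]
  rfl

theorem coords_univ [Fintype ι] : coords F Finset.univ = Map.id _ := by
  simp only [coords, Finset.mem_univ, if_true]
  rfl

theorem coords_insert_homotopic (H : ∀ i, HStructure (F i)) {a : ι} {s : Finset ι} (ha : a ∉ s) :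
    (Map.add (HStructure.pi H) ((incl F a).comp (proj F a)) (coords F s)).Homotopic
      (coords F (insert a s)) := by
  refine Map.homotopic_pi fun i => ?_
  have hassoc : (proj F i).comp ((incl F a).comp (proj F a)) =
      ((proj F i).comp (incl F a)).comp (proj F a) := rfl
  rw [proj_comp_add, hassoc]
  simp only [coords, proj_comp_toPi]
  rcases eq_or_ne i a with rfl | hia
  · rw [proj_comp_incl_self, if_neg ha, if_pos (Finset.mem_insert_self i s)]
    exact (H i).add_zero_homotopic (proj F i)
  · rw [proj_comp_incl_of_ne hia.symm]
    simp only [Finset.mem_insert, hia, false_or]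
    exact (H i).zero_add_homotopic _

variable [∀ i, IsH (F i)]

theorem totalPi_coords (s : Finset ι) :
    (coords F s).totalPi = ∑ i ∈ s, (incl F i).totalPi.comp (proj F i).totalPi := by
  induction s using Finset.induction_on with
  | empty => rw [coords_empty, Map.totalPi_zero, Finset.sum_empty]
  | insert a s ha ih =>
    rw [Finset.sum_insert ha, ← ih, ← Map.totalPi_comp,
      ← (coords_insert_homotopic (fun i => (IsH.nonempty (X := F i)).some) ha).totalPi,
      Map.totalPi_add]

theorem sum_incl_proj [Fintype ι] :
    ∑ i, (incl F i).totalPi.comp (proj F i).totalPi = AddMonoidHom.id _ := by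
  rw [← totalPi_coords, coords_univ, Map.totalPi_id]

omit [DecidableEq ι] in
theorem totalPi_pi_ext [Finite ι] {x y : (pi F).TotalPi}
    (h : ∀ i, (proj F i).totalPi x = (proj F i).totalPi y) : x = y := by
  classical
  cases nonempty_fintype ι
  rw [← AddMonoidHom.id_apply _ x, ← AddMonoidHom.id_apply _ y, ← sum_incl_proj]
  simp only [AddMonoidHom.finsetSum_apply, AddMonoidHom.comp_apply, h]

omit [DecidableEq ι] in
theorem exists_totalPi_proj_eq [Finite ι] (y : ∀ i, (F i).TotalPi) :
    ∃ x : (pi F).TotalPi, ∀ i, (proj F i).totalPi x = y i := by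
  classical
  cases nonempty_fintype ι
  refine ⟨∑ j, (incl F j).totalPi (y j), fun i => ?_⟩
  have hproj (j : ι) : (proj F i).totalPi ((incl F j).totalPi (y j)) =
      if j = i then y i else 0 := by
    rw [← AddMonoidHom.comp_apply, ← Map.totalPi_comp]
    split_ifs with hji
    · subst hji
      rw [proj_comp_incl_self, Map.totalPi_id, AddMonoidHom.id_apply]
    · rw [proj_comp_incl_of_ne hji, Map.totalPi_zero, AddMonoidHom.zero_apply]
  rw [map_sum, Finset.sum_congr rfl fun j _ => hproj j, Finset.sum_ite_eq',
    if_pos (Finset.mem_univ i)]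

end Pi

/-! ### Negatives and retracts -/

section Negatives

variable {X : PtdSpace.{u}} {Z : PtdSpace.{v}}

/-- The property of being an H-space with the homotopy type of a connected CW complex. -/
class IsCWH (X : PtdSpace.{u}) : Prop extends IsH X where
  cw : X.HasConnectedCWType

/-- The shear map `(a, b) ↦ (a, a + b)`, where `a` and `b` are the coordinates at `false` and
`true`. -/
def shear (H : HStructure X) : Map (pi fun _ : Bool => X) (pi fun _ : Bool => X) :=
  Map.toPi fun b => bif b then Map.add H (proj _ false) (proj _ true) else proj _ false

theorem proj_false_shear (H : HStructure X) (x : (pi fun _ : Bool => X).TotalPi) :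
    (proj _ false).totalPi ((shear H).totalPi x) = (proj _ false).totalPi x := by
  rw [← AddMonoidHom.comp_apply, ← Map.totalPi_comp]
  rfl

variable [IsH X]

theorem proj_true_shear (H : HStructure X) (x : (pi fun _ : Bool => X).TotalPi) :
    (proj _ true).totalPi ((shear H).totalPi x) =
      (proj _ false).totalPi x + (proj _ true).totalPi x := by
  rw [← AddMonoidHom.comp_apply, ← Map.totalPi_comp]
  exact DFunLike.congr_fun (Map.totalPi_add H _ _) x

theorem bijective_totalPi_shear (H : HStructure X) : Function.Bijective (shear H).totalPi := by
  refine ⟨fun x y hxy => ?_, fun y => ?_⟩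
  · have hfalse : (proj _ false).totalPi x = (proj _ false).totalPi y := by
      rw [← proj_false_shear H, hxy, proj_false_shear]
    have htrue : (proj _ true).totalPi x = (proj _ true).totalPi y := by
      have := proj_true_shear H x
      rwa [hxy, proj_true_shear, hfalse, add_right_inj, eq_comm] at this
    exact totalPi_pi_ext (Bool.forall_bool.2 ⟨hfalse, htrue⟩)
  · obtain ⟨x, hx⟩ := exists_totalPi_proj_eq (F := fun _ : Bool => X) fun b =>
      bif b then (proj _ true).totalPi y - (proj _ false).totalPi y else (proj _ false).totalPi y
    refine ⟨x, totalPi_pi_ext (Bool.forall_bool.2 ⟨?_, ?_⟩)⟩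
    · rw [proj_false_shear, hx, cond_false]
    · rw [proj_true_shear, hx, hx, cond_false, cond_true, add_sub_cancel]

theorem IsRetract.isH (hZ : Z.IsRetract X) : IsH Z := by
  obtain ⟨H⟩ := IsH.nonempty (X := X)
  obtain ⟨j, p, hpj⟩ := hZ
  let m : C(Z × Z, Z) := p.1.comp (H.toHSpace.hmul.comp (j.1.prodMap j.1))
  have hpt : m (Z.pt, Z.pt) = Z.pt := by
    change p.1 (H.toHSpace.hmul (j.1 Z.pt, j.1 Z.pt)) = Z.pt
    rw [j.2, H.hmul_pt, p.2]
  refine ⟨⟨HStructure.ofHomotopic m hpt ?_ ?_⟩⟩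
  · have hleft : Map.Homotopic _ (Map.id Z) :=
      ((Map.Homotopic.refl p).comp (H.zero_add_homotopic j)).trans hpj
    rwa [show p.comp (Map.add H (Map.zero Z X) j) = ⟨m.comp (.prodMk (.const Z Z.pt) (.id Z)), hpt⟩
      from Map.ext fun x => congrArg (fun y => p.1 (H.toHSpace.hmul (y, j.1 x))) j.2.symm] at hleft
  · have hright : Map.Homotopic _ (Map.id Z) :=
      ((Map.Homotopic.refl p).comp (H.add_zero_homotopic j)).trans hpj
    rwa [show p.comp (Map.add H j (Map.zero Z X)) = ⟨m.comp (.prodMk (.id Z) (.const Z Z.pt)), hpt⟩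
      from Map.ext fun x => congrArg (fun y => p.1 (H.toHSpace.hmul (j.1 x, y))) j.2.symm] at hright

end Negatives

/-- Lifting `(0, 1)` along the shear map gives a map with components `1` and `-1`. -/
theorem exists_totalPi_eq_neg (X : PtdSpace.{u}) [hX : IsCWH X] :
    ∃ ν : Map X X, ν.totalPi = -AddMonoidHom.id _ := by
  have := hX.cw.pathConnectedSpace
  obtain ⟨H⟩ := IsH.nonempty (X := X)
  have : PathConnectedSpace (pi fun _ : Bool => X) :=
    inferInstanceAs (PathConnectedSpace (Bool → X))
  obtain ⟨l, hl⟩ := hX.cw.exists_lift (shear H) (bijective_totalPi_shear H)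
    (Map.toPi fun b => bif b then Map.zero X X else Map.id X)
  refine ⟨(proj _ true).comp l, AddMonoidHom.ext fun x => ?_⟩
  have hproj b : (proj _ b).totalPi ((shear H).totalPi (l.totalPi x)) =
      (bif b then Map.zero X X else Map.id X).totalPi x :=
    DFunLike.congr_fun (((Map.totalPi_comp _ _).trans
      (congrArg _ (Map.totalPi_comp _ _))).symm.trans
        ((Map.Homotopic.refl (proj _ b)).comp hl).totalPi) x
  have hfalse : (proj _ false).totalPi (l.totalPi x) = x := by
    simpa [proj_false_shear, Map.totalPi_id] using hproj false
  have htrue : (proj _ false).totalPi (l.totalPi x) + (proj _ true).totalPi (l.totalPi x) = 0 := by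
    simpa [proj_true_shear, Map.totalPi_zero] using hproj true
  rw [hfalse] at htrue
  rw [Map.totalPi_comp]
  exact eq_neg_of_add_eq_zero_right htrue

end

end PtdSpace

namespace PtdSpace

/-! ### The ring of realizable endomorphisms -/

noncomputable section

variable {X : PtdSpace.{u}} {Y : PtdSpace.{v}} {Z : PtdSpace.{w}}

section PiRing

/-- The ring of those endomorphisms of the homotopy groups of `X` which are induced by self-maps.
It is a quotient of the loop near-ring `End X H`, for every H-structure `H` on `X`. -/
def piRing (X : PtdSpace.{u}) [IsCWH X] : Subring (AddMonoid.End X.TotalPi) where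
  carrier := Set.range Map.totalPi
  zero_mem' := ⟨Map.zero X X, Map.totalPi_zero⟩
  one_mem' := ⟨Map.id X, Map.totalPi_id⟩
  add_mem' := by
    rintro _ _ ⟨f, rfl⟩ ⟨g, rfl⟩
    obtain ⟨H⟩ := IsH.nonempty (X := X)
    exact ⟨Map.add H f g, Map.totalPi_add H f g⟩
  mul_mem' := by
    rintro _ _ ⟨f, rfl⟩ ⟨g, rfl⟩
    exact ⟨f.comp g, Map.totalPi_comp f g⟩
  neg_mem' := by
    rintro _ ⟨f, rfl⟩
    obtain ⟨ν, hν⟩ := exists_totalPi_eq_neg X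
    refine ⟨ν.comp f, (Map.totalPi_comp ν f).trans ?_⟩
    rw [hν]
    rfl

variable [IsCWH X]

/-- The element of `piRing X` induced by a self-map. -/
def Map.toPiRing (f : Map X X) : piRing X := ⟨f.totalPi, f, rfl⟩

theorem Map.toPiRing_surjective : Function.Surjective (Map.toPiRing (X := X)) := by
  rintro ⟨_, f, rfl⟩
  exact ⟨f, rfl⟩

theorem Map.toPiRing_comp (f g : Map X X) : (f.comp g).toPiRing = f.toPiRing * g.toPiRing :=
  Subtype.ext (Map.totalPi_comp f g)

theorem Map.toPiRing_id : (Map.id X).toPiRing = 1 := Subtype.ext Map.totalPi_id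

theorem Map.toPiRing_zero : (Map.zero X X).toPiRing = 0 := Subtype.ext Map.totalPi_zero

theorem Map.Homotopic.toPiRing {f g : Map X X} (h : f.Homotopic g) : f.toPiRing = g.toPiRing :=
  Subtype.ext h.totalPi

theorem bijective_totalPi_of_isUnit {f : Map X X} (h : IsUnit f.toPiRing) :
    Function.Bijective f.totalPi := by
  obtain ⟨b, hb, hb'⟩ := isUnit_iff_exists.mp h
  exact Function.bijective_iff_has_inverse.mpr ⟨(b : AddMonoid.End X.TotalPi),
    DFunLike.congr_fun (congrArg Subtype.val hb'), DFunLike.congr_fun (congrArg Subtype.val hb)⟩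

theorem exists_inverse_of_isUnit_toPiRing {f : Map X X} (h : IsUnit f.toPiRing) :
    ∃ g, (g.comp f).Homotopic (Map.id X) ∧ (f.comp g).Homotopic (Map.id X) :=
  f.exists_inverse IsCWH.cw IsCWH.cw (bijective_totalPi_of_isUnit h)

theorem nontrivial_piRing_iff :
    Nontrivial (piRing X) ↔ ¬ (Map.zero X X).Homotopic (Map.id X) := by
  constructor
  · intro _ h
    have h01 := h.toPiRing
    rw [Map.toPiRing_zero, Map.toPiRing_id] at h01
    exact zero_ne_one h01
  · refine fun h => nontrivial_of_ne 0 1 fun h01 => h ?_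
    obtain ⟨g, hg, -⟩ := exists_inverse_of_isUnit_toPiRing (f := Map.zero X X) <| by
      rw [Map.toPiRing_zero, h01]
      exact isUnit_one
    rwa [show g.comp (Map.zero X X) = Map.zero X X from Map.ext fun _ => g.2] at hg

/-- The canonical epimorphism from the loop near-ring of self-maps to `piRing X`. -/
def endToPiRing (H : HStructure X) : End X H → piRing X :=
  Quotient.lift (s := Map.setoid X X) Map.toPiRing fun _ _ h => Map.Homotopic.toPiRing h

theorem isReflectingEpi_endToPiRing (H : HStructure X) : IsReflectingEpi (endToPiRing H) where
  map_zero := Map.toPiRing_zero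
  map_one := Map.toPiRing_id
  map_add := Quotient.ind₂ fun f g => Subtype.ext (Map.totalPi_add H f g)
  map_mul := Quotient.ind₂ Map.toPiRing_comp
  surjective r := by
    obtain ⟨f, rfl⟩ := Map.toPiRing_surjective r
    exact ⟨Quotient.mk _ f, rfl⟩
  mul_one := Quotient.ind fun _ => rfl
  exists_mul_eq_one {a} ha := by
    obtain ⟨f, rfl⟩ := Quotient.mk_surjective (s := Map.setoid X X) a
    obtain ⟨g, hg, -⟩ := exists_inverse_of_isUnit_toPiRing ha
    exact ⟨Quotient.mk (Map.setoid X X) g, Quotient.sound hg⟩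

theorem stronglyIndecomposable_iff_isLocalRing (H : HStructure X) :
    X.StronglyIndecomposable H ↔ IsLocalRing (piRing X) :=
  (isReflectingEpi_endToPiRing H).isLocalLoopNearRing_iff

end PiRing

/-! ### Retracts and idempotents -/

section Retract

theorem totalPi_comp_apply (g : Map Y Z) (f : Map X Y) (x : X.TotalPi) :
    (g.comp f).totalPi x = g.totalPi (f.totalPi x) :=
  DFunLike.congr_fun (Map.totalPi_comp g f) x

theorem totalPi_retraction {j : Map Z X} {p : Map X Z} (h : (p.comp j).Homotopic (Map.id Z))
    (z : Z.TotalPi) : p.totalPi (j.totalPi z) = z := by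
  rw [← totalPi_comp_apply, h.totalPi, Map.totalPi_id, AddMonoidHom.id_apply]

theorem IsRetract.of_bijective_totalPi_comp [IsCWH Y] {f : Map Z Y} {g : Map Y Z}
    (h : Function.Bijective (f.comp g).totalPi) : Y.IsRetract Z := by
  obtain ⟨k, -, hk⟩ := (f.comp g).exists_inverse IsCWH.cw IsCWH.cw h
  exact ⟨g.comp k, f, hk⟩

/-- If `p j = 1`, then `j p` is an idempotent self-map of `Z` which is not null. -/
theorem Indecomposable.hEquiv_of_isRetract (hZ : Z.Indecomposable)
    (hY : ¬ (Map.zero Y Y).Homotopic (Map.id Y)) (h : Y.IsRetract Z) : Z.HEquiv Y := by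
  obtain ⟨j, p, hpj⟩ := h
  have hidem : ((j.comp p).comp (j.comp p)).Homotopic (j.comp p) :=
    (Map.Homotopic.refl j).comp (hpj.comp (Map.Homotopic.refl p))
  rcases hZ.2 (Quotient.mk _ (j.comp p)) (Quotient.sound hidem) with h0 | h1
  · have hnull : (p.comp ((j.comp p).comp j)).Homotopic (p.comp ((Map.zero Z Z).comp j)) :=
      (Map.Homotopic.refl p).comp ((Quotient.exact h0 :).comp (Map.Homotopic.refl j))
    rw [show p.comp ((Map.zero Z Z).comp j) = Map.zero Y Y from Map.ext fun _ => p.2] at hnull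
    exact absurd (hnull.symm.trans ((hpj.comp hpj :))) hY
  · exact ⟨p, j, Quotient.exact h1, hpj⟩

variable [IsCWH X]

theorem Map.toPiRing_mul_eq_iff {f g h : Map X X} : f.toPiRing * g.toPiRing = h.toPiRing ↔
    ∀ x, f.totalPi (g.totalPi x) = h.totalPi x :=
  Subtype.ext_iff.trans DFunLike.ext_iff

theorem sum_toPiRing_apply {ι : Type*} (s : Finset ι) (f : ι → Map X X) (x : X.TotalPi) :
    (∑ i ∈ s, (f i).toPiRing).1 x = ∑ i ∈ s, (f i).totalPi x := by
  rw [AddSubmonoidClass.coe_finsetSum]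
  exact AddMonoidHom.finsetSum_apply (fun i => (f i).totalPi) s x

theorem isIdempotentElem_toPiRing {j : Map Z X} {p : Map X Z}
    (h : (p.comp j).Homotopic (Map.id Z)) : IsIdempotentElem (j.comp p).toPiRing := by
  refine Map.toPiRing_mul_eq_iff.mpr fun x => ?_
  rw [totalPi_comp_apply, totalPi_comp_apply, totalPi_retraction h]

theorem toPiRing_ne_zero [IsCWH Z] [Nontrivial (piRing Z)] {j : Map Z X} {p : Map X Z}
    (h : (p.comp j).Homotopic (Map.id Z)) : (j.comp p).toPiRing ≠ 0 := by
  refine fun h0 => zero_ne_one (α := piRing Z) (Subtype.ext <| AddMonoidHom.ext fun z => ?_)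
  have hz : (j.comp p).totalPi (j.totalPi z) = 0 := DFunLike.congr_fun (congrArg Subtype.val h0) _
  rw [totalPi_comp_apply, totalPi_retraction h] at hz
  change 0 = z
  rw [← totalPi_retraction h z, hz, map_zero]

theorem mem_corner_toPiRing_iff {j : Map Z X} {p : Map X Z}
    (h : (p.comp j).Homotopic (Map.id Z)) {r : piRing X} :
    r ∈ Subsemigroup.corner (j.comp p).toPiRing ↔
      (∀ x, j.totalPi (p.totalPi (r.1 x)) = r.1 x) ∧
        ∀ x, r.1 (j.totalPi (p.totalPi x)) = r.1 x := by
  simp only [← totalPi_comp_apply]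
  rw [Subsemigroup.mem_corner_iff (isIdempotentElem_toPiRing h)]
  exact and_congr (Subtype.ext_iff.trans DFunLike.ext_iff) (Subtype.ext_iff.trans DFunLike.ext_iff)

/-- The endomorphisms of a retract of `X` form a corner of the ring of endomorphisms of `X`. -/
def cornerEquivPiRing [IsCWH Z] {j : Map Z X} {p : Map X Z}
    (h : (p.comp j).Homotopic (Map.id Z)) :
    piRing Z ≃+* (isIdempotentElem_toPiRing h).Corner where
  toFun r := ⟨⟨j.totalPi.comp (r.1.comp p.totalPi), by
    obtain ⟨_, f, rfl⟩ := r
    exact ⟨j.comp (f.comp p), by rw [Map.totalPi_comp, Map.totalPi_comp]⟩⟩, by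
    refine (mem_corner_toPiRing_iff h).mpr ⟨fun x => ?_, fun x => ?_⟩
    · change j.totalPi (p.totalPi (j.totalPi (r.1 (p.totalPi x)))) = j.totalPi (r.1 (p.totalPi x))
      rw [totalPi_retraction h]
    · change j.totalPi (r.1 (p.totalPi (j.totalPi (p.totalPi x)))) = j.totalPi (r.1 (p.totalPi x))
      rw [totalPi_retraction h]⟩
  invFun r := ⟨p.totalPi.comp (r.1.1.comp j.totalPi), by
    obtain ⟨⟨_, f, rfl⟩, _⟩ := r
    exact ⟨p.comp (f.comp j), by rw [Map.totalPi_comp, Map.totalPi_comp]⟩⟩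
  left_inv r := Subtype.ext <| AddMonoidHom.ext fun z => by
    change p.totalPi (j.totalPi (r.1 (p.totalPi (j.totalPi z)))) = r.1 z
    rw [totalPi_retraction h, totalPi_retraction h]
  right_inv := by
    rintro ⟨r, hr⟩
    obtain ⟨hl, hr⟩ := (mem_corner_toPiRing_iff h).mp hr
    refine Subtype.ext <| Subtype.ext <| AddMonoidHom.ext fun x => ?_
    change j.totalPi (p.totalPi (r.1 (j.totalPi (p.totalPi x)))) = r.1 x
    rw [hl, hr]
  map_mul' r s := Subtype.ext <| Subtype.ext <| AddMonoidHom.ext fun x => by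
    change j.totalPi (r.1 (s.1 (p.totalPi x))) =
      j.totalPi (r.1 (p.totalPi (j.totalPi (s.1 (p.totalPi x)))))
    rw [totalPi_retraction h]
  map_add' r s := Subtype.ext <| Subtype.ext <| AddMonoidHom.ext fun x =>
    j.totalPi.map_add (r.1 (p.totalPi x)) (s.1 (p.totalPi x))

theorem isLocalIdempotent_toPiRing_iff [IsCWH Z] {j : Map Z X} {p : Map X Z}
    (h : (p.comp j).Homotopic (Map.id Z)) :
    IsLocalIdempotent (j.comp p).toPiRing ↔ IsLocalRing (piRing Z) :=
  ⟨fun ⟨_, _⟩ => isLocalRing_of_ringEquiv (cornerEquivPiRing h).symm, fun _ =>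
    ⟨isIdempotentElem_toPiRing h, isLocalRing_of_ringEquiv (cornerEquivPiRing h)⟩⟩

theorem HEquiv.isLocalRing_piRing [IsCWH Y] (h : X.HEquiv Y) (hY : IsLocalRing (piRing Y)) :
    IsLocalRing (piRing X) := by
  obtain ⟨f, g, hgf, hfg⟩ := h
  have hid : ((Map.id Y).comp (Map.id Y)).Homotopic (Map.id Y) := .refl (Map.id Y)
  rw [← isLocalIdempotent_toPiRing_iff hgf, hfg.toPiRing, ← hid.toPiRing]
  exact (isLocalIdempotent_toPiRing_iff hid).mpr hY

theorem hEquiv_of_idempotentEquiv [IsCWH Y] [IsCWH Z] {j : Map Y X} {p : Map X Y} {k : Map Z X}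
    {q : Map X Z} (hpj : (p.comp j).Homotopic (Map.id Y)) (hqk : (q.comp k).Homotopic (Map.id Z))
    (h : IdempotentEquiv (j.comp p).toPiRing (k.comp q).toPiRing) : Y.HEquiv Z := by
  obtain ⟨a, b, -, -, hab, hba⟩ := h
  obtain ⟨f, rfl⟩ := Map.toPiRing_surjective a
  obtain ⟨g, rfl⟩ := Map.toPiRing_surjective b
  rw [Map.toPiRing_mul_eq_iff] at hab hba
  simp only [totalPi_comp_apply] at hab hba
  have hbij : Function.Bijective (q.comp (g.comp j)).totalPi := by
    refine Function.bijective_iff_has_inverse.mpr ⟨(p.comp (f.comp k)).totalPi, fun y => ?_,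
      fun z => ?_⟩
    · simp only [totalPi_comp_apply]
      rw [← hba, hab, hab, totalPi_retraction hpj, totalPi_retraction hpj, totalPi_retraction hpj]
    · simp only [totalPi_comp_apply]
      rw [← hab, hba, hba, totalPi_retraction hqk, totalPi_retraction hqk, totalPi_retraction hqk]
  obtain ⟨r, hr, hr'⟩ := (q.comp (g.comp j)).exists_inverse IsCWH.cw IsCWH.cw hbij
  exact ⟨_, r, hr, hr'⟩

end Retract

/-! ### Product decompositions -/

section Decomposition

variable {ι : Type*} {F : ι → PtdSpace.{v}}

theorem proj_comp_incl_homotopic [DecidableEq ι] {f : Map X (pi F)} {g : Map (pi F) X}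
    (hfg : (f.comp g).Homotopic (Map.id (pi F))) (i k : ι) :
    (((proj F k).comp f).comp (g.comp (incl F i))).Homotopic ((proj F k).comp (incl F i)) :=
  (Map.Homotopic.refl (proj F k)).comp (hfg.comp (Map.Homotopic.refl (incl F i)) :)

theorem HEquiv.isRetract_factor (h : X.HEquiv (pi F)) (i : ι) : (F i).IsRetract X := by
  classical
  obtain ⟨f, g, -, hfg⟩ := h
  exact ⟨_, _, proj_comp_incl_self (F := F) i ▸ proj_comp_incl_homotopic hfg i i⟩

variable [IsCWH X]

theorem HEquiv.exists_retractions [Fintype ι] [∀ i, IsH (F i)] (h : X.HEquiv (pi F)) :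
    ∃ (j : ∀ i, Map (F i) X) (p : ∀ i, Map X (F i)),
      (∀ i, ((p i).comp (j i)).Homotopic (Map.id (F i))) ∧
        CompleteOrthogonalIdempotents fun i => ((j i).comp (p i)).toPiRing := by
  classical
  obtain ⟨f, g, hgf, hfg⟩ := h
  have hretract (i) := proj_comp_incl_self (F := F) i ▸ proj_comp_incl_homotopic hfg i i
  refine ⟨fun i => g.comp (incl F i), fun i => (proj F i).comp f, hretract,
    ⟨fun i => isIdempotentElem_toPiRing (hretract i), fun i k hik => ?_⟩, ?_⟩
  · change Map.toPiRing _ * Map.toPiRing _ = 0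
    rw [← Map.toPiRing_zero, Map.toPiRing_mul_eq_iff]
    intro x
    have hzero := (proj_comp_incl_homotopic hfg k i).totalPi
    rw [proj_comp_incl_of_ne hik.symm, Map.totalPi_zero] at hzero
    rw [totalPi_comp_apply, totalPi_comp_apply _ _ x, ← totalPi_comp_apply _ (g.comp _), hzero,
      Map.totalPi_zero]
    exact map_zero _
  · refine Subtype.ext (AddMonoidHom.ext fun x => (sum_toPiRing_apply _ _ x).trans ?_)
    have hsum := DFunLike.congr_fun (sum_incl_proj (F := F)) (f.totalPi x)
    simp only [AddMonoidHom.finsetSum_apply, AddMonoidHom.comp_apply, AddMonoidHom.id_apply] at hsum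
    simp only [totalPi_comp_apply]
    rw [← map_sum, hsum, totalPi_retraction hgf]
    rfl

theorem Indecomposable.exists_hEquiv_of_isRetract [Finite ι] [∀ i, IsCWH (F i)] [IsCWH Z]
    (hZ : Z.Indecomposable) (h : X.HEquiv (pi F)) (hF : ∀ i, IsLocalRing (piRing (F i)))
    (hr : Z.IsRetract X) : ∃ i, Z.HEquiv (F i) := by
  cases nonempty_fintype ι
  obtain ⟨j, p, hpj, he⟩ := h.exists_retractions
  obtain ⟨k, q, hqk⟩ := hr
  have := nontrivial_piRing_iff.mpr fun hnull => hZ.1 (Quotient.sound hnull)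
  obtain ⟨i, -, u, hfu, hue, heu⟩ := IsLocalIdempotent.exists_exchange (s := Finset.univ)
    (fun i => (isLocalIdempotent_toPiRing_iff (hpj i)).mpr (hF i)) (isIdempotentElem_toPiRing hqk)
    (toPiRing_ne_zero hqk) (by rw [he.complete, mul_one, (isIdempotentElem_toPiRing hqk).eq])
  obtain ⟨m, rfl⟩ := Map.toPiRing_surjective u
  rw [Map.toPiRing_mul_eq_iff] at hfu heu
  have hid : (((p i).comp k).comp (q.comp (m.comp (j i)))).totalPi = AddMonoidHom.id _ := by
    ext1 y
    simp only [totalPi_comp_apply] at hfu heu ⊢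
    rw [hfu, ← totalPi_retraction (hpj i) ((p i).totalPi _), heu, totalPi_retraction (hpj i),
      totalPi_retraction (hpj i), AddMonoidHom.id_apply]
  exact ⟨i, hZ.hEquiv_of_isRetract (nontrivial_piRing_iff.mp (hF i).toNontrivial)
    (.of_bijective_totalPi_comp (by rw [hid]; exact Function.bijective_id))⟩

theorem exists_equiv_hEquiv {κ : Type*} [Finite ι] [Finite κ] {F' : κ → PtdSpace.{w}}
    [∀ i, IsCWH (F i)] [∀ k, IsCWH (F' k)] (h : X.HEquiv (pi F)) (h' : X.HEquiv (pi F'))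
    (hF : ∀ i, IsLocalRing (piRing (F i))) (hF' : ∀ k, IsLocalRing (piRing (F' k))) :
    ∃ σ : ι ≃ κ, ∀ i, (F i).HEquiv (F' (σ i)) := by
  cases nonempty_fintype ι
  cases nonempty_fintype κ
  obtain ⟨j, p, hpj, he⟩ := h.exists_retractions
  obtain ⟨j', p', hpj', he'⟩ := h'.exists_retractions
  obtain ⟨σ, hσ⟩ := exists_equiv_idempotentEquiv he.toOrthogonalIdempotents
    he'.toOrthogonalIdempotents (he.complete.trans he'.complete.symm)
    (fun i => (isLocalIdempotent_toPiRing_iff (hpj i)).mpr (hF i))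
    (fun k => (isLocalIdempotent_toPiRing_iff (hpj' k)).mpr (hF' k))
  exact ⟨σ, fun i => hEquiv_of_idempotentEquiv (hpj i) (hpj' (σ i)) (hσ i)⟩

end Decomposition

end

end PtdSpace

theorem mainTheorem2
    (X : PtdSpace.{u}) (hX : X.HasConnectedCWType) (HX : X.HStructure)
    (n : ℕ) (F : Fin n → PtdSpace.{v}) (hF : ∀ i, (F i).HasConnectedCWType)
    (HF : ∀ i, (F i).HStructure) (hFs : ∀ i, (F i).StronglyIndecomposable (HF i))
    (hXF : X.HEquiv (PtdSpace.pi F)) :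
    (∀ Z : PtdSpace.{w}, Z.HasConnectedCWType → Z.IsRetract X → Z.Indecomposable →
      (Nonempty Z.HStructure ∧ ∀ HZ : Z.HStructure, Z.StronglyIndecomposable HZ) ∧
        ∃ i, Z.HEquiv (F i)) ∧
    (∀ (m : ℕ) (F' : Fin m → PtdSpace.{t}), (∀ k, (F' k).HasConnectedCWType) →
      (∀ k, (F' k).Indecomposable) → X.HEquiv (PtdSpace.pi F') →
      m = n ∧ ∃ φ : Fin n ≃ Fin m, ∀ i, (F i).HEquiv (F' (φ i))) := by
  have : X.IsCWH := { nonempty := ⟨HX⟩, cw := hX }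
  have : ∀ i, (F i).IsCWH := fun i => { nonempty := ⟨HF i⟩, cw := hF i }
  have hFl i := (PtdSpace.stronglyIndecomposable_iff_isLocalRing (HF i)).mp (hFs i)
  refine ⟨fun Z hZc hZr hZ => ?_, fun m F' hFc' hFi' hXF' => ?_⟩
  · have hZH : Z.IsCWH := { hZr.isH with cw := hZc }
    obtain ⟨i, hZF⟩ := hZ.exists_hEquiv_of_isRetract hXF hFl hZr
    have hZl := hZF.isLocalRing_piRing (hFl i)
    exact ⟨⟨hZH.nonempty, fun HZ =>
      (PtdSpace.stronglyIndecomposable_iff_isLocalRing HZ).mpr hZl⟩, i, hZF⟩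
  · have hFr := PtdSpace.HEquiv.isRetract_factor hXF'
    have : ∀ k, (F' k).IsCWH := fun k => { (hFr k).isH with cw := hFc' k }
    have hFl' k : IsLocalRing (F' k).piRing := by
      obtain ⟨i, hi⟩ := (hFi' k).exists_hEquiv_of_isRetract hXF hFl (hFr k)
      exact hi.isLocalRing_piRing (hFl i)
    obtain ⟨σ, hσ⟩ := PtdSpace.exists_equiv_hEquiv hXF hXF' hFl hFl'
    exact ⟨by simpa using (Fintype.card_congr σ).symm, σ, hσ⟩
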